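/- **Theorem 5.1.** Let $H\in(0,1)$, $\nu\in(0,2]$, $\lambda>0$, and let $c$ satisfy $c^2=(2H)^\nu$. Let $N$ be a homogeneous Poisson process with rate $\lambda$, and let $\mathcal G_{H,\nu}=(\mathcal G_{H,\nu}(t))_{t\ge 0}$ be a process independent of $N$ with the one-dimensional laws of the generalized grey Brownian motion, that is, $$\mathbb E\,e^{i\gamma \mathcal G_{H,\nu}(t)}=E_{\nu,1}\Big(-\tfrac{c^2}{(2H)^\nu}\gamma^2t^{2H\nu}\Big),\qquad \gamma\in\mathbb R,\ t\ge0,\qquad E_{a,b}(x)=\sum_{n\ge0}\frac{x^n}{\Gamma(an+b)} .$$ For $0<\alpha\le1$ put $m=2H$ and $${}^C\Big(t^{1-2H}\tfrac{\partial}{\partial t}\Big)^{\alpha}f=L^\alpha\big(f-f(0^+)\big),\qquad L^\alpha f=m^{\alpha}t^{-m\alpha}I_m^{0,-\alpha}f,$$ where for $\beta>0$ $$I_m^{\eta,\beta}f(t)=\frac{t^{-m\eta-m\beta}}{\Gamma(\beta)}\int_0^t(t^m-u^m)^{\beta-1}u^{m\eta}f(u)\,d(u^m),$$ and for $\beta\le0$,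 recursively, $$I_m^{\eta,\beta}f=(\eta+\beta+1)I_m^{\eta,\beta+1}f+\tfrac1m I_m^{\eta,\beta+1}(tf').$$ The operator is applied to functions $f$ that are $C^\infty$ on $(0,\infty)$ and right-continuous at $0$, and for which all integrals involved converge absolutely. Consider the Cauchy problem $$\begin{cases}{}^C\big(t^{1-2H}\frac{\partial}{\partial t}\big)^{\nu/2}p_k(t)=-\lambda'\,(p_k(t)-p_{k-1}(t)),& t>0,\ k\ge0,\quad p_{-1}\equiv 0,\\ p_0(0)=1,\quad p_k(0)=0\ (k>0),\end{cases}\qquad \lambda'=\lambda(2H)^{\nu/2}. \tag{$*$}$$ Then: 1. The state probabilities $p_k(t)=P\{N(|\mathcal G_{H,\nu}(t)|)=k\}$ solve $(*)$. Moreover, for some $1\le p<\infty$ and some $\mu\in\mathbb R$ with $\mu+2H>1/p$, all functions $p_k-p_k(0)$ lie in $F_{p,\mu}$, the space of $f\in C^\infty(0,\infty)$ such that $g(t)=t^{-\mu}f(t)$ satisfies $t^jg^{(j)}\in L^p(0,\infty)$ for all $j\ge0$. 2. There is a counting process $\mathcal N^{H,\nu}$ (started at $0$, with nondecreasing right-continuous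 paths in $\mathbb N_0$) whose state probabilities solve $(*)$ and for which $N(|\mathcal G_{H,\nu}(t)|)\stackrel{d}{=}\mathcal N^{H,\nu}(t)$ for every $t\ge0$. 3. Every $\mathbb N_0$-valued process $(M(t))_{t\ge0}$ whose state probabilities solve $(*)$ satisfies $N(|\mathcal G_{H,\nu}(t)|)\stackrel{d}{=}M(t)$ for every $t\ge0$. 4. For $|u|\le1$ and $t\ge0$, $\ \mathbb E\,u^{N(|\mathcal G_{H,\nu}(t)|)}=E_{\nu/2,1}\big(-\lambda(1-u)t^{H\nu}\big)$. -/

import Mathlib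

open MeasureTheory ProbabilityTheory Set Filter Topology
open scoped NNReal ENNReal

noncomputable section

/-- The two-parameter Mittag-Leffler function `E_{a,b}(x) = ∑ xⁿ / Γ(a n + b)`; the series converges
for every real `x` when `0 < a`. -/
def mittagLeffler (a b x : ℝ) : ℝ :=
  ∑' n : ℕ, x ^ n / Real.Gamma (a * n + b)

/-! ### Erdélyi–Kober operators and fractional powers of `t ^ a d/dt` -/

/-- `(t d/dt) f`. -/
def eulerOp (f : ℝ → ℝ) : ℝ → ℝ := fun t => t * deriv f t

/-- The integrand of the Erdélyi–Kober integral at `t`, with `d(u ^ m) = m u ^ (m - 1) du`. -/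
def ekIntegrand (m η α : ℝ) (f : ℝ → ℝ) (t u : ℝ) : ℝ :=
  (t ^ m - u ^ m) ^ (α - 1) * u ^ (m * η) * f u * (m * u ^ (m - 1))

/-- The Erdélyi–Kober operator after `n` uses of the recursion formula
`I_m^{η,α} f = (η + α + 1) I_m^{η,α+1} f + (1/m) I_m^{η,α+1} (t f')`;
for `n = 0` it is the integral
`I_m^{η,α} f (t) = t^{-mη-mα} / Γ(α) ∫₀ᵗ (t^m - u^m)^{α-1} u^{mη} f(u) d(u^m)`. -/
def ekRec (m η : ℝ) : ℕ → ℝ → (ℝ → ℝ) → ℝ → ℝ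
  | 0, α, f => fun t =>
      t ^ (-(m * η) - m * α) / Real.Gamma α * ∫ u in (0 : ℝ)..t, ekIntegrand m η α f t u
  | n + 1, α, f => fun t =>
      (η + α + 1) * ekRec m η n (α + 1) f t + 1 / m * ekRec m η n (α + 1) (eulerOp f) t

/-- All integrals that occur in `ekRec m η n α f t` with `t > 0` converge absolutely. -/
def EKRecConverges (m η : ℝ) : ℕ → ℝ → (ℝ → ℝ) → Prop
  | 0, α, f => ∀ t : ℝ, 0 < t → IntervalIntegrable (ekIntegrand m η α f t) volume 0 t
  | n + 1, α, f => EKRecConverges m η n (α + 1) f ∧ EKRecConverges m η n (α + 1) (eulerOp f)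

/-- The number of uses of the recursion formula that make the order positive:
none for `α > 0`, the least `n` with `α + n > 0` for `α ≤ 0`. -/
def ekSteps (α : ℝ) : ℕ := if 0 < α then 0 else ⌊-α⌋₊ + 1

/-- The Erdélyi–Kober operator `I_m^{η,α}` of real order `α`: the integral for `α > 0`,
and the recursion formula for `α ≤ 0`. -/
def erdelyiKober (m η α : ℝ) (f : ℝ → ℝ) : ℝ → ℝ := ekRec m η (ekSteps α) α f

/-- McBride's power `L^α f = m^α t^{-mα} I_m^{0,-α} f` of the operator `L = t ^ a d/dt`,
where `m = 1 - a`. -/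
def mcBridePow (a α : ℝ) (f : ℝ → ℝ) : ℝ → ℝ := fun t =>
  (1 - a) ^ α * t ^ (-((1 - a) * α)) * erdelyiKober (1 - a) 0 (-α) f t

/-- The Caputo-like regularization `ᶜL^α f = L^α (f - f(0⁺))` of the power `L^α` of
`L = t ^ a d/dt`, for orders `0 < α ≤ 1`. It is used for functions `f` in `CaputoDomain`,
for which `f 0 = f(0⁺)`. -/
def caputoPow (a α : ℝ) (f : ℝ → ℝ) : ℝ → ℝ := mcBridePow a α (fun t => f t - f 0)

/-- Functions on which `caputoPow a α` is meaningful: smooth on `(0,∞)`, right-continuous at `0`,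
and such that all integrals in the definition converge absolutely. -/
structure CaputoDomain (a α : ℝ) (f : ℝ → ℝ) : Prop where
  tendsto_zero : Tendsto f (𝓝[>] 0) (𝓝 (f 0))
  smooth : ContDiffOn ℝ (⊤ : ℕ∞) f (Ioi 0)
  converges : EKRecConverges (1 - a) 0 (ekSteps (-α)) (-α) (fun t => f t - f 0)

/-- McBride's space `F_p` of smooth `f` on `(0,∞)` with `t^k f^{(k)} ∈ L^p(0,∞)` for all `k`. -/
def MemF (p : ℝ) (f : ℝ → ℝ) : Prop :=
  ContDiffOn ℝ (⊤ : ℕ∞) f (Ioi 0) ∧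
    ∀ k : ℕ, MemLp (fun t => t ^ k * iteratedDerivWithin k f (Ioi 0) t) (ENNReal.ofReal p)
      (volume.restrict (Ioi 0))

/-- McBride's weighted space `F_{p,μ} = {f | t^{-μ} f ∈ F_p}`. -/
def MemFWeighted (p μ : ℝ) (f : ℝ → ℝ) : Prop := MemF p (fun t => t ^ (-μ) * f t)

/-- The backward shift `B p_k = p_{k-1}`, with `p_{-1} = 0`. -/
def backShift (p : ℕ → ℝ → ℝ) : ℕ → ℝ → ℝ
  | 0 => fun _ => 0
  | k + 1 => p k

/-- `p` solves the Cauchy problem `ᶜ(t^{1-2H} d/dt)^α p_k = -κ (1 - B) p_k` for `t > 0` and all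
`k ≥ 0`, with `p_0(0) = 1` and `p_k(0) = 0` for `k > 0`. -/
structure SolvesCauchy (H α κ : ℝ) (p : ℕ → ℝ → ℝ) : Prop where
  domain : ∀ k, CaputoDomain (1 - 2 * H) α (p k)
  equation : ∀ k, ∀ t : ℝ, 0 < t →
    caputoPow (1 - 2 * H) α (p k) t = -κ * (p k t - backShift p k t)
  initial : ∀ k, p k 0 = if k = 0 then 1 else 0

/-! ### Processes -/

/-- A counting process: it starts at `0` and almost surely has nondecreasing, right-continuous
paths in `ℕ`. -/
structure IsCountingProcess {Ω : Type*} [MeasurableSpace Ω] (N : ℝ≥0 → Ω → ℕ) (P : Measure Ω) :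
    Prop where
  measurable : ∀ t, Measurable (N t)
  zero : ∀ᵐ ω ∂P, N 0 ω = 0
  mono : ∀ᵐ ω ∂P, Monotone (fun t => N t ω)
  rightCts : ∀ᵐ ω ∂P, ∀ t, ContinuousWithinAt (fun s => N s ω) (Ici t) t

/-- The homogeneous Poisson process with rate `lam`. -/
structure IsPoissonProcess {Ω : Type*} [MeasurableSpace Ω] (lam : ℝ) (N : ℝ≥0 → Ω → ℕ)
    (P : Measure Ω) : Prop extends IsCountingProcess N P where
  indep : HasIndepIncrements N P
  law : ∀ s t : ℝ≥0, s ≤ t →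
    HasLaw (fun ω => N t ω - N s ω) (poissonMeasure (lam * ((t : ℝ) - s)).toNNReal) P

/-- `G` has the laws of the generalized grey Brownian motion `𝒢_{H,ν}` with diffusivity `c²`:
the characteristic function of `G(t)` is `E_{ν,1}(-(c² / (2H)^ν) γ² t^{2Hν})`.
Only the laws at single times are prescribed, so every process with these laws is included. -/
structure IsGGBM {Ω : Type*} [MeasurableSpace Ω] (H ν c : ℝ) (G : ℝ≥0 → Ω → ℝ)
    (P : Measure Ω) : Prop where
  measurable : ∀ t, Measurable (G t)
  law : ∀ (t : ℝ≥0) (γ : ℝ), charFun (P.map (G t)) γ =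
    (mittagLeffler ν 1 (-(c ^ 2 / (2 * H) ^ ν * γ ^ 2 * (t : ℝ) ^ (2 * H * ν))) : ℂ)

/-- The process `N(|G(t)|)`. -/
def reflectedTimeChange {Ω : Type*} (N : ℝ≥0 → Ω → ℕ) (G : ℝ≥0 → Ω → ℝ) : ℝ≥0 → Ω → ℕ :=
  fun t ω => N ‖G t ω‖₊ ω

/-- The state probabilities `p_k(t) = P(X(t) = k)`, `t ≥ 0`, as functions on the real line
(the values at `t < 0` play no role). -/
def stateProb {Ω : Type*} [MeasurableSpace Ω] (P : Measure Ω) (X : ℝ≥0 → Ω → ℕ) (k : ℕ) :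
    ℝ → ℝ :=
  fun t => P.real {ω | X t.toNNReal ω = k}

end

/-!
The idea is to reduce everything to the law `μ` of `X = G(1)`. Put `a = ν / 2` and `m = 2H`.

*Laplace transform of `|X|`.* The characteristic function of `X` is `E_{2a,1}(-γ²)`. Let `T` be a
standard exponential variable independent of `X`. By the Laplace transform of the Mittag-Leffler
function and analytic continuation, `T ^ a X` has the characteristic function `1 / (1 + γ²)`
(`map_rpow_mul_eq_laplace`), so `T ^ a |X|` is again standard exponential. After scaling `T`, this
gives the Laplace transform of `t ↦ E e^{-t ^ a |X|}`, and it is the one of `t ↦ E_{a,1}(-t ^ a)`.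
Hence `E e^{-s|X|} = E_{a,1}(-s)` (`integral_exp_neg_mul_abs`). As `G(t)` has the law of
`t ^ (m a) X` (`IsGGBM.map_eq`), this is the generating function of `N(|G(t)|)`, and the state
probabilities are the mixed Poisson probabilities `ψₖ(lam * t ^ (m a))`, where
`ψₖ(s) = E e^{-s|X|} (s|X|)^k / k!`.

*The equation.* `ψₖ` is an entire function with the coefficients
`(-1)^{n+k} (n choose k) / Γ(a n + 1)` (`mixedPoisson_eq_powSum`). The Erdélyi–Kober operators
multiply the powers `t ^ (m a n)` by quotients of Gamma functions, by the beta integral for positive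
orders and then by the recursion (`ekRec_powSum`). So the equation holds coefficient by coefficient,
by Pascal's rule (`solvesCauchy_of_eq_powSum`).

*McBride's space.* `ψₖ - ψₖ(0)` is `O(s)` at `0` and bounded, and `s ψₖ' = k ψₖ - (k + 1) ψₖ₊₁`. So
the increments, with a suitable weight, span a space of integrable functions that is stable under
`t d/dt` (`memFWeighted_mixedIncrement`).

*Uniqueness.* In the variable `w = t ^ m` the equation `ᶜL^a f = -κ g` becomes a Caputo equation for
`h(w) = f(w ^ (1/m)) - f(0)`. No growth of the derivative of `f` at `0` is prescribed; Fubini's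
theorem and the continuity of the right-hand side show that the fractional integral of `h` is
differentiable. Then bounded solutions satisfy `m ^ a z ^ a ĥ(z) = -κ ĝ(z)` for all `z > 0`
(`laplace_caputoPow`), and uniqueness follows by induction on `k` from the uniqueness theorem for
the Laplace transform (`SolvesCauchy.eqOn`).

*The counting process.* Let `x` be a path of `N` and let `y` be an independent copy of `X`. Then
`t ↦ x(t ^ (m a) |y|)` is a counting process, and it has the same laws at single times as
`N(|G(t)|)` (`scaledPath`). Paths are recorded on the rational times (`pathFrom`), as this makes
their evaluation at a random time measurable.
-/

/-! ### The Mittag-Leffler function and its Laplace transform -/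

/-- A lower bound for `Γ` that beats every exponential in `x`, as `R` is arbitrary. -/
lemma rpow_mul_exp_neg_le_Gamma {x R : ℝ} (hx : 0 ≤ x) (hR : 0 ≤ R) :
    R ^ x * Real.exp (-R) ≤ Real.Gamma (x + 1) := by
  have hint := Real.GammaIntegral_convergent (s := x + 1) (by linarith)
  rw [Real.Gamma_eq_integral (by linarith)]
  simp only [add_sub_cancel_right] at hint ⊢
  calc R ^ x * Real.exp (-R) = ∫ t in Ioi R, Real.exp (-t) * R ^ x := by
        rw [integral_mul_const, integral_exp_neg_Ioi, mul_comm]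
    _ ≤ ∫ t in Ioi R, Real.exp (-t) * t ^ x := by
        refine setIntegral_mono_on ?_ (hint.mono_set (Ioi_subset_Ioi hR)) measurableSet_Ioi ?_
        · exact (integrableOn_exp_neg_Ioi R).mul_const _
        · intro t ht
          gcongr
          exact le_of_lt ht
    _ ≤ ∫ t in Ioi 0, Real.exp (-t) * t ^ x := by
        refine setIntegral_mono_set hint ?_ (Ioi_subset_Ioi hR).eventuallyLE
        filter_upwards [ae_restrict_mem measurableSet_Ioi] with t ht
        have : (0 : ℝ) < t := ht
        simp only [Pi.zero_apply]
        positivity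

lemma summable_mittagLeffler {a : ℝ} (ha : 0 < a) (x : ℝ) :
    Summable fun n : ℕ => x ^ n / Real.Gamma (a * n + 1) := by
  -- with `R ^ a = 2 |x| + 1`, the `n`-th term is at most `e ^ R 2 ^ (-n)`
  set R : ℝ := (2 * |x| + 1) ^ (1 / a) with hR
  have hR0 : 0 ≤ R := by positivity
  have hRa : R ^ a = 2 * |x| + 1 := by
    rw [hR, ← Real.rpow_mul (by positivity), one_div, inv_mul_cancel₀ ha.ne', Real.rpow_one]
  refine Summable.of_norm_bounded
    ((summable_geometric_of_lt_one (r := 1 / 2) (by norm_num) (by norm_num)).mul_left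
      (Real.exp R)) fun n => ?_
  have hG := rpow_mul_exp_neg_le_Gamma (x := a * n) (R := R) (by positivity) hR0
  have hGpos : 0 < Real.Gamma (a * n + 1) := Real.Gamma_pos_of_pos (by positivity)
  rw [Real.rpow_mul hR0, hRa, Real.rpow_natCast, Real.exp_neg] at hG
  rw [norm_div, norm_pow, Real.norm_eq_abs, Real.norm_of_nonneg hGpos.le, div_le_iff₀ hGpos]
  calc |x| ^ n ≤ (1 / 2) ^ n * (2 * |x| + 1) ^ n := by
        rw [← mul_pow]; gcongr; linarith [abs_nonneg x]
    _ = Real.exp R * (1 / 2) ^ n * ((2 * |x| + 1) ^ n * (Real.exp R)⁻¹) := by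
        field_simp
    _ ≤ _ := by gcongr

lemma continuous_mittagLeffler {a : ℝ} (ha : 0 < a) : Continuous (mittagLeffler a 1) := by
  rw [continuous_iff_continuousAt]
  intro x
  have hon : ContinuousOn (mittagLeffler a 1) (Icc (-(|x| + 1)) (|x| + 1)) := by
    refine continuousOn_tsum (u := fun n : ℕ => (|x| + 1) ^ n / Real.Gamma (a * n + 1))
      (fun n => by fun_prop) (summable_mittagLeffler ha _) fun n y hy => ?_
    have hGpos : 0 < Real.Gamma (a * n + 1) := Real.Gamma_pos_of_pos (by positivity)
    rw [norm_div, norm_pow, Real.norm_eq_abs, Real.norm_of_nonneg hGpos.le]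
    gcongr
    exact abs_le.2 hy
  refine hon.continuousAt (Icc_mem_nhds ?_ ?_)
  · linarith [neg_abs_le x]
  · linarith [le_abs_self x]

lemma mittagLeffler_zero {a : ℝ} : mittagLeffler a 1 0 = 1 := by
  rw [mittagLeffler, tsum_eq_single 0 (fun n hn => by simp [hn])]
  simp

lemma integrableOn_exp_neg_mul {z : ℝ} (hz : 0 < z) :
    IntegrableOn (fun t : ℝ => Real.exp (-(z * t))) (Ioi 0) := by
  simpa [neg_mul] using integrableOn_exp_mul_Ioi (neg_lt_zero.2 hz) 0

/-- The Laplace transform of `t ↦ E_{a,1}(x t ^ a)`, for `z` so large that the series can be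
integrated termwise. -/
lemma integral_exp_mul_mittagLeffler {a z x : ℝ} (ha : 0 < a) (hz : 0 < z) (hx : |x| < z ^ a) :
    ∫ t in Ioi 0, Real.exp (-(z * t)) * mittagLeffler a 1 (x * t ^ a) =
      z⁻¹ * (1 - x / z ^ a)⁻¹ := by
  have hza : 0 < z ^ a := by positivity
  have hterm : ∀ n : ℕ, EqOn
      (fun t : ℝ => Real.exp (-(z * t)) * ((x * t ^ a) ^ n / Real.Gamma (a * n + 1)))
      (fun t : ℝ => x ^ n / Real.Gamma (a * n + 1) *
        (t ^ ((a * n + 1) - 1) * Real.exp (-(z * t)))) (Ioi 0) := by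
    intro n t ht
    have ht0 : (0 : ℝ) ≤ t := le_of_lt ht
    simp only [add_sub_cancel_right, mul_pow, ← Real.rpow_natCast, ← Real.rpow_mul ht0]
    ring
  have hI : ∀ c : ℝ, ∀ n : ℕ, ∫ t in Ioi 0, c / Real.Gamma (a * n + 1) *
      (t ^ ((a * n + 1) - 1) * Real.exp (-(z * t))) = z⁻¹ * (c / (z ^ a) ^ n) := by
    intro c n
    have hpos : 0 < a * n + 1 := by positivity
    have hGpos : 0 < Real.Gamma (a * n + 1) := Real.Gamma_pos_of_pos hpos
    rw [integral_const_mul, Real.integral_rpow_mul_exp_neg_mul_Ioi hpos hz, one_div,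
      Real.inv_rpow hz.le, Real.rpow_add_one hz.ne', Real.rpow_mul hz.le, Real.rpow_natCast]
    field_simp
  have hint : ∀ n : ℕ, IntegrableOn
      (fun t : ℝ => Real.exp (-(z * t)) * ((x * t ^ a) ^ n / Real.Gamma (a * n + 1))) (Ioi 0) := by
    intro n
    refine IntegrableOn.congr_fun (Integrable.const_mul ?_ _) (hterm n).symm measurableSet_Ioi
    refine Integrable.of_integral_ne_zero ?_
    have hpos : 0 < a * n + 1 := by positivity
    have hGpos : 0 < Real.Gamma (a * n + 1) := Real.Gamma_pos_of_pos hpos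
    rw [Real.integral_rpow_mul_exp_neg_mul_Ioi hpos hz]
    positivity
  have hgeo : |x / z ^ a| < 1 := by
    rwa [abs_div, abs_of_pos hza, div_lt_one hza]
  have hnorm : Summable fun n : ℕ => ∫ t in Ioi 0,
      ‖Real.exp (-(z * t)) * ((x * t ^ a) ^ n / Real.Gamma (a * n + 1))‖ := by
    have : ∀ n : ℕ, ∫ t in Ioi 0,
        ‖Real.exp (-(z * t)) * ((x * t ^ a) ^ n / Real.Gamma (a * n + 1))‖ =
        z⁻¹ * |x / z ^ a| ^ n := by
      intro n
      rw [abs_div, abs_of_pos hza, div_pow, ← hI (|x| ^ n) n]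
      refine setIntegral_congr_fun measurableSet_Ioi fun t ht => ?_
      have hGpos : 0 < Real.Gamma (a * n + 1) := Real.Gamma_pos_of_pos (by positivity)
      have ht0 : (0 : ℝ) < t := ht
      have h1 := hterm n ht
      simp only at h1 ⊢
      rw [h1, norm_mul, norm_div, norm_pow, Real.norm_eq_abs, Real.norm_of_nonneg hGpos.le,
        Real.norm_of_nonneg (by positivity)]
    simp only [this]
    exact (summable_geometric_of_lt_one (abs_nonneg _) hgeo).mul_left _
  have hsum := hasSum_integral_of_summable_integral_norm hint hnorm
  have hsum2 : HasSum (fun n : ℕ => ∫ t in Ioi 0,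
      Real.exp (-(z * t)) * ((x * t ^ a) ^ n / Real.Gamma (a * n + 1)))
      (z⁻¹ * (1 - x / z ^ a)⁻¹) := by
    have : (fun n : ℕ => ∫ t in Ioi 0,
        Real.exp (-(z * t)) * ((x * t ^ a) ^ n / Real.Gamma (a * n + 1))) =
        fun n : ℕ => z⁻¹ * (x / z ^ a) ^ n := by
      ext n
      rw [setIntegral_congr_fun measurableSet_Ioi (hterm n), hI, div_pow]
    rw [this]
    exact (hasSum_geometric_of_abs_lt_one hgeo).mul_left _
  rw [hsum2.unique hsum]
  simp only [mittagLeffler, tsum_mul_left]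

lemma integrableOn_exp_mul_mittagLeffler {a z x : ℝ} (ha : 0 < a) (hz : 0 < z)
    (hx : |x| < z ^ a) :
    IntegrableOn (fun t => Real.exp (-(z * t)) * mittagLeffler a 1 (x * t ^ a)) (Ioi 0) := by
  have hza : 0 < z ^ a := by positivity
  have habs : IntegrableOn
      (fun t => Real.exp (-(z * t)) * mittagLeffler a 1 (|x| * t ^ a)) (Ioi 0) := by
    refine Integrable.of_integral_ne_zero ?_
    rw [integral_exp_mul_mittagLeffler ha hz (by rwa [abs_abs])]
    have : |x| / z ^ a < 1 := by rwa [div_lt_one hza]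
    have : 0 < 1 - |x| / z ^ a := by linarith
    positivity
  refine habs.mono' ?_ ?_
  · refine ContinuousOn.aestronglyMeasurable ?_ measurableSet_Ioi
    refine ContinuousOn.mul (by fun_prop) ((continuous_mittagLeffler ha).comp_continuousOn ?_)
    exact continuousOn_const.mul (continuousOn_id.rpow_const fun t ht => Or.inl (ne_of_gt ht))
  · filter_upwards [ae_restrict_mem measurableSet_Ioi] with t ht
    have ht0 : (0 : ℝ) < t := ht
    have key : ∀ n : ℕ, ‖(x * t ^ a) ^ n / Real.Gamma (a * n + 1)‖ =
        (|x| * t ^ a) ^ n / Real.Gamma (a * n + 1) := by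
      intro n
      have hGpos : 0 < Real.Gamma (a * n + 1) := Real.Gamma_pos_of_pos (by positivity)
      rw [norm_div, norm_pow, norm_mul, Real.norm_eq_abs, Real.norm_of_nonneg hGpos.le,
        Real.norm_of_nonneg (by positivity)]
    rw [norm_mul, Real.norm_of_nonneg (Real.exp_pos _).le]
    gcongr
    rw [mittagLeffler, mittagLeffler]
    simp only [← key]
    refine norm_tsum_le_tsum_norm ?_
    simp only [key]
    exact summable_mittagLeffler ha _

/-! ### Uniqueness for the Laplace transform -/

/-- An integrable function on `(0,∞)` is determined by its Laplace transform at the natural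
numbers: these are the moments in the variable `e ^ (-t)`, and Weierstrass' theorem applies. -/
theorem ae_eq_zero_of_forall_integral_exp_neg_nat_mul {g : ℝ → ℝ} (hg : IntegrableOn g (Ioi 0))
    (h : ∀ n : ℕ, ∫ t in Ioi 0, Real.exp (-(n * t)) * g t = 0) :
    ∀ᵐ t, t ∈ Ioi (0 : ℝ) → g t = 0 := by
  have hbd : ∀ φ : ℝ → ℝ, ContinuousOn φ (Icc 0 1) →
      IntegrableOn (fun t => φ (Real.exp (-t)) * g t) (Ioi 0) := by
    intro φ hφ
    obtain ⟨C, hC⟩ := isCompact_Icc.exists_bound_of_continuousOn hφ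
    have hmem : ∀ t ∈ Ioi (0 : ℝ), Real.exp (-t) ∈ Icc (0 : ℝ) 1 := fun t ht =>
      ⟨(Real.exp_pos _).le, Real.exp_le_one_iff.2 (neg_nonpos.2 (le_of_lt ht))⟩
    refine Integrable.bdd_mul (c := C) hg ?_ ?_
    · exact (hφ.comp (by fun_prop) hmem).aestronglyMeasurable measurableSet_Ioi
    · filter_upwards [ae_restrict_mem measurableSet_Ioi] with t ht using hC _ (hmem t ht)
  have hpoly : ∀ p : Polynomial ℝ, ∫ t in Ioi 0, p.eval (Real.exp (-t)) * g t = 0 := by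
    intro p
    induction p using Polynomial.induction_on' with
    | add p q hp hq =>
      simp only [Polynomial.eval_add, add_mul]
      rw [integral_add (hbd _ p.continuousOn) (hbd _ q.continuousOn), hp, hq, add_zero]
    | monomial n c =>
      have : ∀ t : ℝ, (Polynomial.monomial n c).eval (Real.exp (-t)) * g t =
          c * (Real.exp (-(n * t)) * g t) := by
        intro t
        rw [Polynomial.eval_monomial, ← Real.exp_nat_mul]
        ring_nf
      simp only [this]
      rw [integral_const_mul, h n, mul_zero]
  have hcont : ∀ φ : ℝ → ℝ, ContinuousOn φ (Icc 0 1) →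
      ∫ t in Ioi 0, φ (Real.exp (-t)) * g t = 0 := by
    intro φ hφ
    have hle : ∀ ε > 0, ‖∫ t in Ioi 0, φ (Real.exp (-t)) * g t‖ ≤ ε * ∫ t in Ioi 0, ‖g t‖ := by
      intro ε hε
      obtain ⟨p, hp⟩ := exists_polynomial_near_of_continuousOn 0 1 φ hφ ε hε
      have : ∫ t in Ioi 0, φ (Real.exp (-t)) * g t =
          ∫ t in Ioi 0, (φ (Real.exp (-t)) * g t - p.eval (Real.exp (-t)) * g t) := by
        rw [integral_sub (hbd φ hφ) (hbd _ p.continuousOn), hpoly, sub_zero]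
      rw [this, ← integral_const_mul]
      refine norm_integral_le_of_norm_le (hg.norm.const_mul ε) ?_
      filter_upwards [ae_restrict_mem measurableSet_Ioi] with t ht
      rw [← sub_mul, norm_mul]
      gcongr
      rw [norm_sub_rev]
      exact (hp _ ⟨(Real.exp_pos _).le, Real.exp_le_one_iff.2 (neg_nonpos.2 (le_of_lt ht))⟩).le
    by_contra hne
    have hpos : 0 < ‖∫ t in Ioi 0, φ (Real.exp (-t)) * g t‖ := norm_pos_iff.2 hne
    have hI : 0 ≤ ∫ t in Ioi 0, ‖g t‖ := integral_nonneg fun _ => norm_nonneg _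
    have := hle (‖∫ t in Ioi 0, φ (Real.exp (-t)) * g t‖ / (2 * ((∫ t in Ioi 0, ‖g t‖) + 1)))
      (by positivity)
    rw [div_mul_eq_mul_div, le_div_iff₀ (by positivity)] at this
    nlinarith
  refine isOpen_Ioi.ae_eq_zero_of_integral_contDiff_smul_eq_zero
    (hg.locallyIntegrableOn) fun ψ hψ hc hsupp => ?_
  have h0 : ψ 0 = 0 := by
    by_contra hne
    exact lt_irrefl (0 : ℝ) (mem_Ioi.1 (hsupp (subset_tsupport _ hne)))
  have hcomp : ContinuousOn (fun x => ψ (-Real.log x)) (Icc 0 1) := by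
    intro x hx
    rcases eq_or_lt_of_le hx.1 with rfl | hx0
    · have hlim : Tendsto ψ atTop (𝓝 0) := by
        refine Tendsto.congr' ?_ tendsto_const_nhds
        obtain ⟨R, hR⟩ := hc.isCompact.isBounded.subset_closedBall 0
        filter_upwards [eventually_gt_atTop R] with t ht
        by_contra hne
        have := hR (subset_tsupport ψ (Ne.symm hne))
        rw [mem_closedBall_zero_iff, Real.norm_eq_abs] at this
        linarith [le_abs_self t]
      have h1 : Tendsto (fun x => ψ (-Real.log x)) (𝓝[>] 0) (𝓝 0) :=
        hlim.comp (tendsto_neg_atBot_atTop.comp Real.tendsto_log_nhdsGT_zero)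
      have h2 : ContinuousWithinAt (fun x => ψ (-Real.log x)) (Ioi 0) 0 := by
        simpa [ContinuousWithinAt, h0] using h1
      refine (continuousWithinAt_insert_self.2 h2).mono fun y hy => ?_
      rcases eq_or_lt_of_le hy.1 with h | h
      · exact Or.inl h.symm
      · exact Or.inr h
    · exact (hψ.continuous.continuousAt.comp
        (Real.continuousAt_log hx0.ne').neg).continuousWithinAt
  have := hcont _ hcomp
  simp only [Real.log_exp, neg_neg] at this
  rw [← this, setIntegral_eq_integral_of_forall_compl_eq_zero]
  · rfl
  · intro t ht
    have : ψ t = 0 := by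
      by_contra hne
      exact ht (hsupp (subset_tsupport _ hne))
    simp [this]

/-- A continuous function on `(0,∞)` whose Laplace transform exists and vanishes from some point on
is zero. -/
theorem eqOn_zero_of_laplace_eq_zero {f : ℝ → ℝ} (hf : ContinuousOn f (Ioi 0)) {z₀ : ℝ}
    (hint : IntegrableOn (fun t => Real.exp (-(z₀ * t)) * f t) (Ioi 0))
    (h : ∀ z ≥ z₀, ∫ t in Ioi 0, Real.exp (-(z * t)) * f t = 0) : EqOn f 0 (Ioi 0) := by
  have hae := ae_eq_zero_of_forall_integral_exp_neg_nat_mul hint fun n => by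
    refine Eq.trans (integral_congr_ae (ae_of_all _ fun t => ?_))
      (h (z₀ + n) (by linarith [n.cast_nonneg (α := ℝ)]))
    simp only
    rw [← mul_assoc, ← Real.exp_add]
    ring_nf
  refine Measure.eqOn_open_of_ae_eq (μ := volume) ?_ isOpen_Ioi hf continuousOn_const
  rw [Filter.EventuallyEq, ae_restrict_iff' measurableSet_Ioi]
  filter_upwards [hae] with t ht ht0
  simpa [(Real.exp_pos _).ne'] using ht ht0

/-! ### From the characteristic function to the Laplace transform of the absolute value -/

/-- The Laplace transform of a bounded continuous function is analytic on `(0,∞)`. -/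
lemma analyticOnNhd_laplace {f : ℝ → ℝ} (hf : Continuous f) (hb : ∀ t, 0 < t → |f t| ≤ 1) :
    AnalyticOnNhd ℝ (fun z => ∫ t in Ioi 0, Real.exp (-(z * t)) * f t) (Ioi 0) := by
  -- for nonnegative `g`, the Laplace transform of `g` is the moment generating function of `-t`
  -- under the measure `g(t) dt`
  have key : ∀ g : ℝ → ℝ, Continuous g → (∀ t, 0 < t → 0 ≤ g t) → (∀ t, 0 < t → g t ≤ 2) →
      AnalyticOnNhd ℝ (fun z => ∫ t in Ioi 0, Real.exp (-(z * t)) * g t) (Ioi 0) := by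
    intro g hg h0 h2
    set μ : Measure ℝ := (volume.restrict (Ioi 0)).withDensity (fun t => ENNReal.ofReal (g t))
    have hmeas : Measurable fun t => ENNReal.ofReal (g t) := hg.measurable.ennreal_ofReal
    have hexp : ∀ z : ℝ, 0 < z → IntegrableOn (fun t : ℝ => Real.exp (-(z * t))) (Ioi 0) :=
      fun z hz => integrableOn_exp_neg_mul hz
    have hset : Ioi 0 ⊆ integrableExpSet (fun t : ℝ => -t) μ := by
      intro z hz
      have hz : (0 : ℝ) < z := hz
      change Integrable _ _
      rw [integrable_withDensity_iff_integrable_smul' hmeas (ae_of_all _ fun _ => by simp)]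
      refine Integrable.bdd_mul (c := 2) (by simpa [IntegrableOn] using hexp z hz)
        hmeas.ennreal_toReal.aestronglyMeasurable ?_
      filter_upwards [ae_restrict_mem measurableSet_Ioi] with t ht
      rw [ENNReal.toReal_ofReal (h0 t ht), Real.norm_of_nonneg (h0 t ht)]
      exact h2 t ht
    have han := (analyticOnNhd_mgf (X := fun t : ℝ => -t) (μ := μ)).mono
      (interior_maximal hset isOpen_Ioi)
    refine han.congr isOpen_Ioi fun z hz => ?_
    simp only [mgf, μ]
    rw [integral_withDensity_eq_integral_toReal_smul hmeas (ae_of_all _ fun _ => by simp)]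
    refine setIntegral_congr_fun measurableSet_Ioi fun t ht => ?_
    simp only [smul_eq_mul]
    rw [ENNReal.toReal_ofReal (h0 t ht), mul_comm]
    ring_nf
  have h1 := key (fun t => 1 + f t) (by fun_prop)
    (fun t ht => by linarith [neg_abs_le (f t), hb t ht])
    (fun t ht => by linarith [le_abs_self (f t), hb t ht])
  have h2 := key (fun _ => 1) (by fun_prop) (fun t ht => by norm_num) (fun t ht => by norm_num)
  refine (h1.sub h2).congr isOpen_Ioi fun z hz => ?_
  have hz : (0 : ℝ) < z := hz
  have hexp := integrableOn_exp_neg_mul hz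
  simp only [Pi.sub_apply, mul_one]
  rw [← integral_sub _ hexp]
  · congr 1 with t
    ring
  · refine Integrable.mul_bdd (c := 2) hexp (by fun_prop) ?_
    filter_upwards [ae_restrict_mem measurableSet_Ioi] with t ht
    rw [Real.norm_eq_abs, abs_le]
    constructor <;> linarith [neg_abs_le (f t), le_abs_self (f t), hb t ht]

/-- If `γ ↦ E_{2a,1}(-γ²)` is bounded by `1`, the formula for the Laplace transform of
`t ↦ E_{2a,1}(-(γ t ^ a)²)` extends from large `z`, where the series can be integrated termwise,
to all `z > 0`. -/
lemma integral_exp_mul_mittagLeffler_of_bounded {a : ℝ} (ha : 0 < a)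
    (hb : ∀ γ, |mittagLeffler (2 * a) 1 (-γ ^ 2)| ≤ 1) (γ : ℝ) {z : ℝ} (hz : 0 < z) :
    ∫ t in Ioi 0, Real.exp (-(z * t)) * mittagLeffler (2 * a) 1 (-γ ^ 2 * t ^ (2 * a)) =
      z⁻¹ * (1 + γ ^ 2 / z ^ (2 * a))⁻¹ := by
  have h2a : 0 < 2 * a := by positivity
  have hcont : Continuous fun t : ℝ => mittagLeffler (2 * a) 1 (-γ ^ 2 * t ^ (2 * a)) :=
    (continuous_mittagLeffler h2a).comp
      (continuous_const.mul (Real.continuous_rpow_const h2a.le))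
  have han := analyticOnNhd_laplace hcont fun t ht => by
    have := hb (γ * t ^ a)
    rwa [mul_pow, ← Real.rpow_mul_natCast ht.le, Nat.cast_ofNat, mul_comm a 2, ← neg_mul] at this
  have han' : AnalyticOnNhd ℝ (fun z : ℝ => z⁻¹ * (1 + γ ^ 2 / z ^ (2 * a))⁻¹) (Ioi 0) := by
    intro z hz
    have hz : (0 : ℝ) < z := hz
    have hp : AnalyticAt ℝ (fun z : ℝ => z ^ (2 * a)) z := by
      have : AnalyticAt ℝ (fun z : ℝ => Real.exp (Real.log z * (2 * a))) z := by
        refine AnalyticAt.rexp (AnalyticAt.mul (analyticAt_log hz) analyticAt_const)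
      refine this.congr ?_
      filter_upwards [eventually_gt_nhds hz] with y hy
      rw [Real.rpow_def_of_pos hy]
    have hzp : 0 < z ^ (2 * a) := by positivity
    exact (analyticAt_id.inv hz.ne').mul
      ((analyticAt_const.add (analyticAt_const.div hp hzp.ne')).inv
        (ne_of_gt (by change 0 < 1 + γ ^ 2 / z ^ (2 * a); positivity)))
  refine han.eqOn_of_preconnected_of_eventuallyEq han' isPreconnected_Ioi
    (z₀ := (γ ^ 2 + 1) ^ (1 / (2 * a))) (mem_Ioi.2 (by positivity)) ?_ hz
  have hlt : γ ^ 2 < ((γ ^ 2 + 1) ^ (1 / (2 * a))) ^ (2 * a) := by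
    rw [← Real.rpow_mul (by positivity), one_div, inv_mul_cancel₀ h2a.ne', Real.rpow_one]
    linarith
  filter_upwards [(Real.continuous_rpow_const h2a.le).continuousAt.eventually_const_lt hlt,
    eventually_gt_nhds (show (0 : ℝ) < (γ ^ 2 + 1) ^ (1 / (2 * a)) by positivity)] with y hy hy0
  rw [integral_exp_mul_mittagLeffler h2a hy0 (by rwa [abs_neg, abs_of_nonneg (sq_nonneg γ)])]
  ring

/-- The standard exponential distribution, as the measure `e ^ (-t) dt` on `(0,∞)`. -/
noncomputable def stdExp : Measure ℝ :=
  (volume.restrict (Ioi 0)).withDensity fun t => ENNReal.ofReal (Real.exp (-t))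

lemma integral_stdExp {E : Type*} [NormedAddCommGroup E] [NormedSpace ℝ E] (f : ℝ → E) :
    ∫ t, f t ∂stdExp = ∫ t in Ioi 0, Real.exp (-t) • f t := by
  rw [stdExp, integral_withDensity_eq_integral_toReal_smul (by fun_prop)
    (ae_of_all _ fun _ => by simp)]
  simp [ENNReal.toReal_ofReal (Real.exp_pos _).le]

instance : IsProbabilityMeasure stdExp := by
  constructor
  rw [stdExp, withDensity_apply _ MeasurableSet.univ, Measure.restrict_univ,
    ← ofReal_integral_eq_lintegral_ofReal (integrableOn_exp_neg_Ioi 0)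
      (ae_of_all _ fun _ => (Real.exp_pos _).le), integral_exp_neg_Ioi]
  simp

lemma charFun_stdExp (γ : ℝ) : charFun stdExp γ = (1 - γ * Complex.I)⁻¹ := by
  rw [charFun_apply_real, integral_stdExp]
  have hre : (-1 + γ * Complex.I).re < 0 := by simp
  have := integral_exp_mul_complex_Ioi hre 0
  rw [Complex.ofReal_zero, mul_zero, Complex.exp_zero] at this
  rw [show (1 - γ * Complex.I)⁻¹ = -1 / (-1 + γ * Complex.I) by
    rw [show (-1 + γ * Complex.I) = -(1 - γ * Complex.I) by ring, neg_div_neg_eq, one_div], ← this]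
  refine integral_congr_ae (ae_of_all _ fun t => ?_)
  simp only [Complex.real_smul, Complex.ofReal_exp, ← Complex.exp_add]
  congr 1
  push_cast
  ring

/-- Let `μ` have the characteristic function `E_{2a,1}(-γ²)` and let `T` be an independent standard
exponential variable. Then `T ^ a X` has the Laplace distribution, with characteristic
function `1 / (1 + γ²)`. -/
lemma map_rpow_mul_eq_laplace {a : ℝ} (ha : 0 < a) (μ : Measure ℝ) [IsProbabilityMeasure μ]
    (hμ : ∀ γ, charFun μ γ = (mittagLeffler (2 * a) 1 (-γ ^ 2) : ℂ)) :
    (stdExp.prod μ).map (fun p => p.1 ^ a * p.2) =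
      (2⁻¹ : ℝ≥0) • (stdExp + stdExp.map (fun t => -t)) := by
  have hmeas : Measurable fun p : ℝ × ℝ => p.1 ^ a * p.2 := by fun_prop
  have : IsProbabilityMeasure (stdExp.map (fun t => -t)) :=
    Measure.isProbabilityMeasure_map (by fun_prop)
  refine Measure.ext_of_charFun (funext fun γ => ?_)
  have hb : ∀ γ, |mittagLeffler (2 * a) 1 (-γ ^ 2)| ≤ 1 := fun γ => by
    have := norm_charFun_le_one (μ := μ) γ
    rwa [hμ, Complex.norm_real] at this
  have hleft : charFun ((stdExp.prod μ).map (fun p => p.1 ^ a * p.2)) γ =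
      ((1 + γ ^ 2)⁻¹ : ℝ) := by
    rw [charFun_apply_real, integral_map hmeas.aemeasurable (by fun_prop), integral_prod]
    · have h1 := integral_exp_mul_mittagLeffler_of_bounded ha hb γ one_pos
      simp only [Real.one_rpow, div_one, inv_one, one_mul] at h1
      rw [← h1, ← integral_complex_ofReal, integral_stdExp]
      refine setIntegral_congr_fun measurableSet_Ioi fun t ht => ?_
      have ht : (0 : ℝ) < t := ht
      have h2 := hμ (γ * t ^ a)
      rw [charFun_apply_real] at h2
      simp only [Complex.real_smul, Complex.ofReal_mul]
      congr 1
      rw [mul_pow, ← Real.rpow_mul_natCast ht.le, Nat.cast_ofNat, mul_comm a 2, ← neg_mul] at h2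
      rw [← h2]
      congr 1 with x
      push_cast
      ring_nf
    · refine (integrable_const (1 : ℝ)).mono' (by fun_prop) (ae_of_all _ fun p => ?_)
      rw [← Complex.ofReal_mul, Complex.norm_exp_ofReal_mul_I]
  have hright : charFun ((2⁻¹ : ℝ≥0) • (stdExp + stdExp.map (fun t => -t))) γ =
      ((1 + γ ^ 2)⁻¹ : ℝ) := by
    have hneg : charFun (stdExp.map (fun t => -t)) γ = (1 + γ * Complex.I)⁻¹ := by
      have := charFun_map_mul (μ := stdExp) (-1) γ
      simp only [neg_mul, one_mul] at this
      rw [this, charFun_stdExp]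
      push_cast
      ring
    have hi : ∀ ρ : Measure ℝ, IsProbabilityMeasure ρ →
        Integrable (fun x : ℝ => Complex.exp (γ * x * Complex.I)) ρ := by
      intro ρ _
      refine (integrable_const (1 : ℝ)).mono' (by fun_prop) (ae_of_all _ fun x => ?_)
      rw [← Complex.ofReal_mul, Complex.norm_exp_ofReal_mul_I]
    rw [charFun_apply_real, integral_smul_nnreal_measure, integral_add_measure (hi _ inferInstance)
      (hi _ inferInstance), ← charFun_apply_real, ← charFun_apply_real, charFun_stdExp, hneg]
    have h1 : (1 - γ * Complex.I) ≠ 0 := fun h => by simpa using congrArg Complex.re h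
    have h2 : (1 + γ * Complex.I) ≠ 0 := fun h => by simpa using congrArg Complex.re h
    have h3 : ((1 + γ ^ 2 : ℝ) : ℂ) = (1 - γ * Complex.I) * (1 + γ * Complex.I) := by
      push_cast
      linear_combination ((γ : ℂ) ^ 2) * Complex.I_sq
    rw [Complex.ofReal_inv, h3, NNReal.smul_def]
    simp only [Complex.real_smul]
    push_cast
    field_simp
    ring
  rw [hleft, hright]

/-- If `μ` has the characteristic function `E_{2a,1}(-γ²)`, then the absolute value has the Laplace
transform `E_{a,1}(-s)`. -/
theorem integral_exp_neg_mul_abs {a : ℝ} (ha : 0 < a) (μ : Measure ℝ)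
    [IsProbabilityMeasure μ] (hμ : ∀ γ, charFun μ γ = (mittagLeffler (2 * a) 1 (-γ ^ 2) : ℂ))
    {s : ℝ} (hs : 0 ≤ s) : ∫ x, Real.exp (-(s * |x|)) ∂μ = mittagLeffler a 1 (-s) := by
  set F : ℝ → ℝ := fun s => ∫ x, Real.exp (-(s * |x|)) ∂μ with hF
  have hFb : ∀ s, 0 ≤ s → ∀ x : ℝ, ‖Real.exp (-(s * |x|))‖ ≤ 1 := fun s hs x => by
    rw [Real.norm_of_nonneg (Real.exp_pos _).le, Real.exp_le_one_iff]
    have := mul_nonneg hs (abs_nonneg x)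
    linarith
  have hFc : ContinuousOn F (Ici 0) := by
    refine continuousOn_of_dominated (bound := fun _ => 1) (fun s _ => by fun_prop)
      (fun s hs => ae_of_all _ (hFb s hs)) (integrable_const _) (ae_of_all _ fun x => by fun_prop)
  have h1 : ∀ s, 0 ≤ s → ∫ t in Ioi 0, Real.exp (-t) * F (s * t ^ a) = (1 + s)⁻¹ := by
    intro s hs
    have hlap := map_rpow_mul_eq_laplace ha μ hμ
    have hm : Measurable fun p : ℝ × ℝ => p.1 ^ a * p.2 := by fun_prop
    have hl : ∫ y, Real.exp (-(s * |y|)) ∂((stdExp.prod μ).map (fun p => p.1 ^ a * p.2)) =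
        ∫ t in Ioi 0, Real.exp (-t) * F (s * t ^ a) := by
      rw [integral_map hm.aemeasurable (by fun_prop), integral_prod, integral_stdExp]
      · refine setIntegral_congr_fun measurableSet_Ioi fun t ht => ?_
        have ht : (0 : ℝ) < t := ht
        simp only [smul_eq_mul, hF, abs_mul, abs_of_pos (Real.rpow_pos_of_pos ht a), mul_assoc]
      · exact (integrable_const (1 : ℝ)).mono' (by fun_prop) (ae_of_all _ fun p => hFb s hs _)
    have : IsProbabilityMeasure (stdExp.map (fun t => -t)) :=
      Measure.isProbabilityMeasure_map (by fun_prop)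
    have hi : ∀ ρ : Measure ℝ, IsProbabilityMeasure ρ →
        Integrable (fun x : ℝ => Real.exp (-(s * |x|))) ρ := by
      intro ρ _
      exact (integrable_const (1 : ℝ)).mono' (by fun_prop) (ae_of_all _ fun x => hFb s hs x)
    rw [← hl, hlap, integral_smul_nnreal_measure, integral_add_measure (hi _ inferInstance)
      (hi _ inferInstance), integral_map (by fun_prop) (by fun_prop)]
    simp only [abs_neg]
    have : ∫ x, Real.exp (-(s * |x|)) ∂stdExp = (1 + s)⁻¹ := by
      rw [integral_stdExp]
      have h2 : EqOn (fun t : ℝ => Real.exp (-t) • Real.exp (-(s * |t|)))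
          (fun t => Real.exp (-(1 + s) * t)) (Ioi 0) := by
        intro t ht
        have ht : (0 : ℝ) < t := ht
        simp only [smul_eq_mul, ← Real.exp_add, abs_of_pos ht]
        ring_nf
      rw [setIntegral_congr_fun measurableSet_Ioi h2, integral_exp_mul_Ioi (by linarith)]
      rw [mul_zero, Real.exp_zero, neg_div_neg_eq, one_div]
    rw [this, NNReal.smul_def]
    simp only [smul_eq_mul]
    push_cast
    ring
  have h2 : ∀ z, 0 < z → ∫ t in Ioi 0, Real.exp (-(z * t)) * F (t ^ a) =
      z⁻¹ * (1 + 1 / z ^ a)⁻¹ := by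
    intro z hz
    rw [← h1 (1 / z ^ a) (by positivity)]
    have := integral_comp_mul_left_Ioi (fun t => Real.exp (-t) * F (1 / z ^ a * t ^ a)) 0 hz
    rw [mul_zero] at this
    rw [← smul_eq_mul, ← this]
    refine setIntegral_congr_fun measurableSet_Ioi fun t ht => ?_
    have ht : (0 : ℝ) < t := ht
    simp only [Real.mul_rpow hz.le ht.le]
    congr 2
    field_simp
  have hpow : ContinuousOn (fun t : ℝ => t ^ a) (Ioi 0) :=
    (Real.continuous_rpow_const ha.le).continuousOn
  have hFa : ContinuousOn (fun t => F (t ^ a)) (Ioi 0) :=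
    hFc.comp hpow fun t ht => mem_Ici.2 (Real.rpow_nonneg (le_of_lt ht) a)
  have hone : ∀ z : ℝ, 2 ≤ z → |(-1 : ℝ)| < z ^ a := fun z hz => by
    rw [abs_neg, abs_one]
    exact Real.one_lt_rpow (by linarith) ha
  have hintF : ∀ z : ℝ, 2 ≤ z →
      IntegrableOn (fun t => Real.exp (-(z * t)) * F (t ^ a)) (Ioi 0) := by
    intro z hz
    have hexp := integrableOn_exp_neg_mul (show 0 < z by linarith)
    refine Integrable.mul_bdd (c := 1) hexp (hFa.aestronglyMeasurable measurableSet_Ioi) ?_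
    filter_upwards [ae_restrict_mem measurableSet_Ioi] with t ht
    have := norm_integral_le_of_norm_le_const (μ := μ)
      (ae_of_all _ (hFb _ (Real.rpow_nonneg (le_of_lt ht) a)))
    simpa using this
  have hzero := eqOn_zero_of_laplace_eq_zero
    (f := fun t => F (t ^ a) - mittagLeffler a 1 (-1 * t ^ a)) (z₀ := 2)
    (hFa.sub ((continuous_mittagLeffler ha).comp_continuousOn (continuousOn_const.mul hpow)))
    (by
      simp only [mul_sub]
      exact (hintF 2 le_rfl).sub
        (integrableOn_exp_mul_mittagLeffler ha two_pos (hone 2 le_rfl)))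
    (fun z hz => by
      have hz0 : 0 < z := by linarith
      simp only [mul_sub]
      rw [integral_sub (hintF z hz) (integrableOn_exp_mul_mittagLeffler ha hz0 (hone z hz)),
        h2 z hz0, integral_exp_mul_mittagLeffler ha hz0 (hone z hz)]
      ring)
  rcases hs.eq_or_lt with rfl | hs
  · simp [mittagLeffler_zero]
  · have := hzero (x := s ^ (1 / a)) (mem_Ioi.2 (by positivity))
    simp only [Pi.zero_apply] at this
    rw [← Real.rpow_mul hs.le, one_div, inv_mul_cancel₀ ha.ne', Real.rpow_one,
      neg_one_mul] at this
    exact sub_eq_zero.1 this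

/-! ### Entire power series -/

/-- The real power series `∑ bₙ rⁿ` converges absolutely for every `r`. -/
def EntireCoeff (b : ℕ → ℝ) : Prop := ∀ r : ℝ, Summable fun n => |b n * r ^ n|

/-- The sum of a real power series. -/
noncomputable def powSum (b : ℕ → ℝ) (s : ℝ) : ℝ := ∑' n, b n * s ^ n

namespace EntireCoeff

variable {b : ℕ → ℝ}

lemma hasSum (hb : EntireCoeff b) (s : ℝ) : HasSum (fun n => b n * s ^ n) (powSum b s) :=
  (hb s).of_abs.hasSum

lemma natCast_mul (hb : EntireCoeff b) : EntireCoeff fun n => n * b n := fun r => by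
  refine Summable.of_nonneg_of_le (fun n => abs_nonneg _) (fun n => ?_) (hb (2 * r))
  rw [mul_assoc, abs_mul, Nat.abs_cast, mul_pow, mul_left_comm, abs_mul (2 ^ n)]
  gcongr
  rw [abs_of_pos (by positivity)]
  exact_mod_cast Nat.lt_two_pow_self.le

lemma const_mul (hb : EntireCoeff b) (c : ℝ) : EntireCoeff fun n => c * b n := fun r => by
  simp only [mul_assoc, abs_mul c]
  exact (hb r).mul_left _

lemma mul_pow (hb : EntireCoeff b) (c : ℝ) : EntireCoeff fun n => b n * c ^ n := fun r => by
  simp only [mul_assoc, ← _root_.mul_pow]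
  exact hb (c * r)

lemma shift (hb : EntireCoeff b) : EntireCoeff fun n => b (n + 1) := fun r => by
  by_cases hr : r = 0
  · refine summable_of_ne_finset_zero (s := {0}) fun n hn => ?_
    simp [hr, Finset.notMem_singleton.1 hn]
  · refine (((summable_nat_add_iff 1).2 (hb r)).mul_left |r|⁻¹).congr fun n => ?_
    rw [pow_succ, ← mul_assoc, abs_mul _ r]
    field_simp

lemma deriv (hb : EntireCoeff b) : EntireCoeff fun n => ((n + 1 : ℕ) : ℝ) * b (n + 1) :=
  hb.natCast_mul.shift

lemma hasDerivAt_powSum (hb : EntireCoeff b) (s : ℝ) :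
    HasDerivAt (powSum b) (powSum (fun n => ((n + 1 : ℕ) : ℝ) * b (n + 1)) s) s := by
  have hterm : ∀ (n : ℕ) (y : ℝ), HasDerivAt (fun y => b n * y ^ n) (b n * (n * y ^ (n - 1))) y :=
    fun n y => (hasDerivAt_pow n y).const_mul _
  set R := |s| + 1
  have hu : Summable fun n : ℕ => |b n| * (n * R ^ (n - 1)) := by
    refine (summable_nat_add_iff 1).1 ((hb.deriv R).congr fun n => ?_)
    rw [abs_mul, abs_mul, abs_of_pos (pow_pos (by positivity : 0 < R) n), Nat.abs_cast]
    simp only [Nat.add_sub_cancel]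
    ring
  have hd := hasDerivAt_tsum_of_isPreconnected hu isOpen_Ioo
    (isPreconnected_Ioo (a := -R) (b := R)) (fun n y _ => hterm n y) (fun n y hy => ?_)
    (y₀ := s) (y := s) ⟨by linarith [neg_abs_le s], by linarith [le_abs_self s]⟩
    (hb s).of_abs ⟨by linarith [neg_abs_le s], by linarith [le_abs_self s]⟩
  · refine (show HasDerivAt (powSum b) _ s from hd).congr_deriv ?_
    have hs : Summable fun n : ℕ => b n * (n * s ^ (n - 1)) := by
      refine (summable_nat_add_iff 1).1 ((hb.deriv s).of_abs.congr fun n => ?_)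
      simp only [Nat.add_sub_cancel]
      ring
    rw [hs.tsum_eq_zero_add, powSum]
    simp only [CharP.cast_eq_zero, zero_mul, mul_zero, zero_add, Nat.add_sub_cancel]
    refine tsum_congr fun n => ?_
    ring
  · rw [norm_mul, norm_mul, norm_pow, Real.norm_natCast, Real.norm_eq_abs, Real.norm_eq_abs]
    gcongr
    exact (abs_lt.2 hy).le

lemma mul_powSum_deriv (hb : EntireCoeff b) (s : ℝ) :
    s * powSum (fun n => ((n + 1 : ℕ) : ℝ) * b (n + 1)) s = powSum (fun n => n * b n) s := by
  rw [powSum, powSum, (hb.natCast_mul s).of_abs.tsum_eq_zero_add, ← tsum_mul_left]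
  simp only [CharP.cast_eq_zero, zero_mul, zero_add]
  refine tsum_congr fun n => ?_
  ring

lemma contDiff_powSum (hb : EntireCoeff b) : ContDiff ℝ (⊤ : ℕ∞) (powSum b) := by
  rw [contDiff_infty]
  intro n
  induction n generalizing b with
  | zero =>
    exact contDiff_zero.2 (continuous_iff_continuousAt.2 fun s =>
      (hb.hasDerivAt_powSum s).continuousAt)
  | succ n ih =>
    rw [Nat.cast_add, Nat.cast_one, contDiff_succ_iff_deriv]
    refine ⟨fun s => (hb.hasDerivAt_powSum s).differentiableAt, by simp, ?_⟩
    rw [show _root_.deriv (powSum b) = powSum fun n => ((n + 1 : ℕ) : ℝ) * b (n + 1) from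
      funext fun s => (hb.hasDerivAt_powSum s).deriv]
    exact ih hb.deriv

lemma continuous_powSum (hb : EntireCoeff b) : Continuous (powSum b) :=
  hb.contDiff_powSum.continuous

end EntireCoeff

lemma powSum_zero (b : ℕ → ℝ) : powSum b 0 = b 0 := by
  rw [powSum, tsum_eq_single 0 fun n hn => by simp [hn]]
  simp

/-! ### Mixed Poisson probabilities -/

/-- The probability that a Poisson variable with the random mean `s |X|` is equal to `k`, where `X`
has the law `μ`. -/
noncomputable def mixedPoisson (μ : Measure ℝ) (k : ℕ) (s : ℝ) : ℝ :=
  ∫ x, Real.exp (-(s * |x|)) * (s * |x|) ^ k / k.factorial ∂μ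

lemma integrable_exp_neg_mul_pow (μ : Measure ℝ) [IsFiniteMeasure μ] (k : ℕ) {s : ℝ} (hs : 0 ≤ s) :
    Integrable (fun x => Real.exp (-(s * |x|)) * (s * |x|) ^ k / k.factorial) μ := by
  refine (integrable_const (1 : ℝ)).mono' (by fun_prop) (ae_of_all _ fun x => ?_)
  have hx : 0 ≤ s * |x| := by positivity
  rw [Real.norm_of_nonneg (by positivity), mul_div_assoc, Real.exp_neg,
    inv_mul_le_iff₀ (Real.exp_pos _), mul_one]
  exact Real.pow_div_factorial_le_exp _ hx k

lemma mixedPoisson_le_one (μ : Measure ℝ) [IsProbabilityMeasure μ] (k : ℕ) {s : ℝ} (hs : 0 ≤ s) :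
    mixedPoisson μ k s ≤ 1 := by
  have : ∫ _, (1 : ℝ) ∂μ = 1 := by simp
  rw [← this]
  refine integral_mono (integrable_exp_neg_mul_pow μ k hs) (integrable_const _) fun x => ?_
  have hx : 0 ≤ s * |x| := by positivity
  simp only
  rw [mul_div_assoc, Real.exp_neg, inv_mul_le_iff₀ (Real.exp_pos _), mul_one]
  exact Real.pow_div_factorial_le_exp _ hx k

lemma mixedPoisson_nonneg (μ : Measure ℝ) (k : ℕ) {s : ℝ} (hs : 0 ≤ s) :
    0 ≤ mixedPoisson μ k s := integral_nonneg fun x => by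
  simp only [Pi.zero_apply]
  positivity

lemma mixedPoisson_zero (μ : Measure ℝ) [IsProbabilityMeasure μ] (k : ℕ) :
    mixedPoisson μ k 0 = if k = 0 then 1 else 0 := by
  rcases k with _ | k <;> simp [mixedPoisson]

/-- The recursion `s ψₖ' = k ψₖ - (k + 1) ψₖ₊₁` for the mixed Poisson probabilities. -/
lemma hasDerivAt_mixedPoisson (μ : Measure ℝ) [IsFiniteMeasure μ] (k : ℕ) {s : ℝ} (hs : 0 < s) :
    HasDerivAt (mixedPoisson μ k)
      ((k * mixedPoisson μ k s - (k + 1) * mixedPoisson μ (k + 1) s) / s) s := by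
  set J : ℕ → ℝ → ℝ := fun k s => ∫ x, (-|x|) ^ k * Real.exp (s * -|x|) ∂μ with hJ
  have hset : Ioi 0 ⊆ integrableExpSet (fun x : ℝ => -|x|) μ := fun r hr => by
    have hr : (0 : ℝ) < r := hr
    refine (integrable_const (1 : ℝ)).mono' (by fun_prop) (ae_of_all _ fun x => ?_)
    rw [Real.norm_of_nonneg (Real.exp_pos _).le, Real.exp_le_one_iff]
    have := mul_nonneg hr.le (abs_nonneg x)
    linarith
  have hJd : HasDerivAt (J k) (J (k + 1) s) s :=
    hasDerivAt_integral_pow_mul_exp_real (interior_maximal hset isOpen_Ioi hs) k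
  have hmp : ∀ k s, mixedPoisson μ k s = (-s) ^ k / k.factorial * J k s := fun k s => by
    rw [mixedPoisson, hJ, ← integral_const_mul]
    congr 1 with x
    rw [show s * |x| = (-s) * (-|x|) by ring, mul_pow, show -(-s * -|x|) = s * -|x| by ring]
    ring
  have hpow : HasDerivAt (fun s : ℝ => (-s) ^ k / (k.factorial : ℝ))
      (k * (-s) ^ (k - 1) * (-1) / k.factorial) s :=
    ((hasDerivAt_neg s).pow k).div_const _
  have hd := hpow.mul hJd
  refine (hd.congr_of_eventuallyEq (Eventually.of_forall fun s => hmp k s)).congr_deriv ?_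
  rw [hmp, hmp, Nat.factorial_succ]
  push_cast
  rcases k with _ | k
  · simp
    field_simp
  · simp only [Nat.add_sub_cancel]
    push_cast
    field_simp
    ring

/-- The coefficients of the power series of the mixed Poisson probabilities. -/
noncomputable def mixedCoeff (a : ℝ) (k n : ℕ) : ℝ :=
  (-1) ^ (n + k) * n.choose k / Real.Gamma (a * n + 1)

lemma entireCoeff_mixedCoeff {a : ℝ} (ha : 0 < a) (k : ℕ) : EntireCoeff (mixedCoeff a k) := by
  intro r
  refine Summable.of_nonneg_of_le (fun n => abs_nonneg _) (fun n => ?_)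
    (summable_mittagLeffler ha (2 * |r|))
  have hG : 0 < Real.Gamma (a * n + 1) := Real.Gamma_pos_of_pos (by positivity)
  rw [mixedCoeff, abs_mul, abs_div, abs_mul, abs_pow, abs_neg, abs_one, one_pow, one_mul,
    Nat.abs_cast, abs_of_pos hG, abs_pow, mul_pow, div_mul_eq_mul_div]
  gcongr
  exact_mod_cast Nat.choose_le_two_pow n k

lemma mixedCoeff_succ (a : ℝ) (k n : ℕ) :
    mixedCoeff a (k + 1) n = (k * mixedCoeff a k n - n * mixedCoeff a k n) / (k + 1) := by
  have h : ((n.choose (k + 1) : ℕ) : ℝ) * (k + 1) = n.choose k * ((n : ℝ) - k) := by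
    rcases le_or_gt k n with hk | hk
    · rw [← Nat.cast_sub hk]
      exact_mod_cast Nat.choose_succ_right_eq n k
    · simp [Nat.choose_eq_zero_of_lt hk, Nat.choose_eq_zero_of_lt (Nat.lt_succ_of_lt hk)]
  have hk : (k : ℝ) + 1 ≠ 0 := by positivity
  rw [eq_div_iff hk, mixedCoeff, mixedCoeff, div_mul_eq_mul_div, mul_assoc, h]
  ring

/-- If `|X|` has the Laplace transform `E_{a,1}(-s)`, the mixed Poisson probabilities are entire
functions of `s`. -/
theorem mixedPoisson_eq_powSum {a : ℝ} (ha : 0 < a) (μ : Measure ℝ) [IsProbabilityMeasure μ]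
    (hμ : ∀ s, 0 ≤ s → ∫ x, Real.exp (-(s * |x|)) ∂μ = mittagLeffler a 1 (-s)) (k : ℕ) {s : ℝ}
    (hs : 0 ≤ s) : mixedPoisson μ k s = powSum (mixedCoeff a k) s := by
  rcases hs.eq_or_lt with rfl | hs
  · rw [mixedPoisson_zero, powSum_zero, mixedCoeff]
    rcases k with _ | k <;> simp
  induction k generalizing s with
  | zero =>
    simp only [mixedPoisson, pow_zero, mul_one, Nat.factorial_zero, Nat.cast_one, div_one]
    rw [hμ s hs.le, mittagLeffler, powSum]
    refine tsum_congr fun n => ?_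
    rw [mixedCoeff, neg_pow s n]
    simp
    ring
  | succ k ih =>
    have hd := hasDerivAt_mixedPoisson μ k hs
    have heq : mixedPoisson μ k =ᶠ[𝓝 s] powSum (mixedCoeff a k) := by
      filter_upwards [eventually_gt_nhds hs] with y hy using ih hy.le hy
    have hd' := ((entireCoeff_mixedCoeff ha k).hasDerivAt_powSum s).congr_of_eventuallyEq heq
    have h1 := hd.unique hd'
    rw [div_eq_iff hs.ne', mul_comm _ s, (entireCoeff_mixedCoeff ha k).mul_powSum_deriv,
      ih hs.le hs]
      at h1
    have h2 : powSum (mixedCoeff a (k + 1)) s =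
        (k * powSum (mixedCoeff a k) s - powSum (fun n => n * mixedCoeff a k n) s) / (k + 1) := by
      have hsum := ((((entireCoeff_mixedCoeff ha k).hasSum s).mul_left (k : ℝ)).sub
        ((entireCoeff_mixedCoeff ha k).natCast_mul.hasSum s)).div_const ((k : ℝ) + 1)
      rw [← hsum.tsum_eq, powSum]
      refine tsum_congr fun n => ?_
      rw [mixedCoeff_succ]
      ring
    rw [h2, eq_div_iff (by positivity)]
    linarith

/-! ### The Erdélyi–Kober integral in the variable `t ^ m` -/

/-- The integral `∫₀¹ (1 - x)^{β-1} h(τ x) dx`, which is `Γ(β)` times the Erdélyi–Kober integral of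
order `β` in the variable `τ = t ^ m`. -/
noncomputable def betaMean (β : ℝ) (h : ℝ → ℝ) (τ : ℝ) : ℝ :=
  ∫ x in (0 : ℝ)..1, (1 - x) ^ (β - 1) * h (τ * x)

/-- The integral `betaMean β h τ` converges absolutely for every `τ > 0`. -/
def BetaConverges (β : ℝ) (h : ℝ → ℝ) : Prop :=
  ∀ τ : ℝ, 0 < τ → IntervalIntegrable (fun x => (1 - x) ^ (β - 1) * h (τ * x)) volume 0 1

lemma indicator_ekIntegrand {m β t : ℝ} (hm : 0 < m) (ht : 0 < t) (f : ℝ → ℝ) {u : ℝ}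
    (hu : u ∈ Ioi (0 : ℝ)) :
    (m * u ^ (m - 1)) • (Iic (t ^ m)).indicator
      (fun w => (t ^ m - w) ^ (β - 1) * f (w ^ (1 / m))) (u ^ m) =
    (Iic t).indicator (ekIntegrand m 0 β f t) u := by
  have hu0 : (0 : ℝ) < u := hu
  by_cases h : u ≤ t
  · rw [indicator_of_mem (show u ^ m ∈ Iic (t ^ m) from Real.rpow_le_rpow hu0.le h hm.le),
      indicator_of_mem (mem_Iic.2 h), ekIntegrand,
      ← Real.rpow_mul hu0.le, mul_one_div_cancel hm.ne', Real.rpow_one, mul_zero, Real.rpow_zero,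
      smul_eq_mul]
    ring
  · rw [indicator_of_notMem (s := Iic t) (mt mem_Iic.1 h), indicator_of_notMem, smul_zero]
    rwa [mem_Iic, Real.rpow_le_rpow_iff hu0.le ht.le hm]

lemma intervalIntegral_eq_indicator_Ioi {g : ℝ → ℝ} {t : ℝ} (ht : 0 ≤ t) :
    ∫ u in (0 : ℝ)..t, g u = ∫ u in Ioi 0, (Iic t).indicator g u := by
  rw [intervalIntegral.integral_of_le ht, setIntegral_indicator measurableSet_Iic, Ioi_inter_Iic]

lemma intervalIntegrable_iff_indicator_Ioi {g : ℝ → ℝ} {t : ℝ} (ht : 0 ≤ t) :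
    IntervalIntegrable g volume 0 t ↔ IntegrableOn ((Iic t).indicator g) (Ioi 0) := by
  rw [intervalIntegrable_iff_integrableOn_Ioc_of_le ht, IntegrableOn, IntegrableOn,
    integrable_indicator_iff measurableSet_Iic, IntegrableOn, Measure.restrict_restrict
    measurableSet_Iic, inter_comm, Ioi_inter_Iic]

lemma integral_ekIntegrand {m β t : ℝ} (hm : 0 < m) (ht : 0 < t) (f : ℝ → ℝ) :
    ∫ u in (0 : ℝ)..t, ekIntegrand m 0 β f t u =
      ∫ w in (0 : ℝ)..t ^ m, (t ^ m - w) ^ (β - 1) * f (w ^ (1 / m)) := by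
  rw [intervalIntegral_eq_indicator_Ioi ht.le, intervalIntegral_eq_indicator_Ioi (by positivity),
    ← integral_comp_rpow_Ioi_of_pos (g := (Iic (t ^ m)).indicator _) hm]
  exact setIntegral_congr_fun measurableSet_Ioi fun u hu => (indicator_ekIntegrand hm ht f hu).symm

lemma intervalIntegrable_ekIntegrand_iff {m β t : ℝ} (hm : 0 < m) (ht : 0 < t) (f : ℝ → ℝ) :
    IntervalIntegrable (ekIntegrand m 0 β f t) volume 0 t ↔
      IntervalIntegrable (fun w => (t ^ m - w) ^ (β - 1) * f (w ^ (1 / m))) volume 0 (t ^ m) := by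
  rw [intervalIntegrable_iff_indicator_Ioi ht.le, intervalIntegrable_iff_indicator_Ioi
    (by positivity), ← integrableOn_Ioi_comp_rpow_iff ((Iic (t ^ m)).indicator _) hm.ne',
    abs_of_pos hm]
  exact integrableOn_congr_fun (fun u hu => (indicator_ekIntegrand hm ht f hu).symm)
    measurableSet_Ioi

lemma sub_rpow_comp_mul {β τ : ℝ} (hτ : 0 < τ) (h : ℝ → ℝ) {x : ℝ} (hx : x ≤ 1) :
    (τ - τ * x) ^ (β - 1) * h (τ * x) = τ ^ (β - 1) * ((1 - x) ^ (β - 1) * h (τ * x)) := by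
  rw [show τ - τ * x = τ * (1 - x) by ring, Real.mul_rpow hτ.le (by linarith), mul_assoc]

lemma integral_sub_rpow_mul {β τ : ℝ} (hτ : 0 < τ) (h : ℝ → ℝ) :
    ∫ w in (0 : ℝ)..τ, (τ - w) ^ (β - 1) * h w = τ ^ β * betaMean β h τ := by
  have h1 := intervalIntegral.integral_comp_mul_left (a := 0) (b := 1)
    (fun w => (τ - w) ^ (β - 1) * h w) hτ.ne'
  rw [mul_zero, mul_one, smul_eq_mul, eq_comm, inv_mul_eq_iff_eq_mul₀ hτ.ne'] at h1
  have h2 : τ ^ β = τ * τ ^ (β - 1) := by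
    rw [mul_comm, ← Real.rpow_add_one hτ.ne', sub_add_cancel]
  rw [h1, h2, betaMean, mul_assoc, ← intervalIntegral.integral_const_mul (τ ^ (β - 1))]
  refine congrArg (τ * ·) (intervalIntegral.integral_congr fun x hx => ?_)
  rw [uIcc_of_le zero_le_one] at hx
  exact sub_rpow_comp_mul hτ h hx.2

lemma intervalIntegrable_sub_rpow_mul_iff {β τ : ℝ} (hτ : 0 < τ) (h : ℝ → ℝ) :
    IntervalIntegrable (fun w => (τ - w) ^ (β - 1) * h w) volume 0 τ ↔
      IntervalIntegrable (fun x => (1 - x) ^ (β - 1) * h (τ * x)) volume 0 1 := by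
  have hc : τ ^ (β - 1) ≠ 0 := by positivity
  have h1 : IntervalIntegrable (fun w => (τ - w) ^ (β - 1) * h w) volume 0 τ ↔
      IntervalIntegrable (fun x => (τ - τ * x) ^ (β - 1) * h (τ * x)) volume 0 1 := by
    have := IntervalIntegrable.comp_mul_left_iff (a := 0) (b := τ)
      (f := fun w => (τ - w) ^ (β - 1) * h w) hτ.ne'
    rw [zero_div, div_self hτ.ne'] at this
    exact this.symm
  have h2 : IntervalIntegrable (fun x => (τ - τ * x) ^ (β - 1) * h (τ * x)) volume 0 1 ↔
      IntervalIntegrable (fun x => τ ^ (β - 1) * ((1 - x) ^ (β - 1) * h (τ * x))) volume 0 1 := by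
    refine intervalIntegrable_congr fun x hx => ?_
    rw [uIoc_of_le zero_le_one] at hx
    exact sub_rpow_comp_mul hτ h hx.2
  rw [h1, h2]
  refine ⟨fun h => ?_, fun h => h.const_mul _⟩
  have := h.const_mul (τ ^ (β - 1))⁻¹
  simpa only [← mul_assoc, inv_mul_cancel₀ hc, one_mul] using this

lemma ekRec_zero_eq_betaMean {m β t : ℝ} (hm : 0 < m) (ht : 0 < t) (f : ℝ → ℝ) :
    ekRec m 0 0 β f t =
      (Real.Gamma β)⁻¹ * betaMean β (fun w => f (w ^ (1 / m))) (t ^ m) := by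
  have htm : 0 < t ^ m := by positivity
  simp only [ekRec]
  rw [integral_ekIntegrand hm ht, integral_sub_rpow_mul htm (fun w => f (w ^ (1 / m))),
    mul_zero, neg_zero, zero_sub, Real.rpow_neg ht.le, Real.rpow_mul ht.le]
  have : (t ^ m) ^ β ≠ 0 := by positivity
  field_simp

lemma ekRecConverges_zero_iff {m β : ℝ} (hm : 0 < m) (f : ℝ → ℝ) :
    EKRecConverges m 0 0 β f ↔ BetaConverges β (fun w => f (w ^ (1 / m))) := by
  constructor
  · intro h τ hτ
    have h1 := (intervalIntegrable_ekIntegrand_iff hm (Real.rpow_pos_of_pos hτ (1 / m)) f).1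
      (h _ (by positivity))
    rw [← Real.rpow_mul hτ.le, one_div_mul_cancel hm.ne', Real.rpow_one] at h1
    exact (intervalIntegrable_sub_rpow_mul_iff hτ _).1 h1
  · intro h t ht
    exact (intervalIntegrable_ekIntegrand_iff hm ht f).2
      ((intervalIntegrable_sub_rpow_mul_iff (by positivity) _).2 (h _ (by positivity)))

lemma eulerOp_rpow {m w : ℝ} (hm : 0 < m) (hw : 0 < w) {f : ℝ → ℝ}
    (hf : DifferentiableAt ℝ f (w ^ (1 / m))) :
    eulerOp f (w ^ (1 / m)) = m * eulerOp (fun w => f (w ^ (1 / m))) w := by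
  have h1 : HasDerivAt (fun w : ℝ => w ^ (1 / m)) (1 / m * w ^ (1 / m - 1)) w :=
    Real.hasDerivAt_rpow_const (Or.inl hw.ne')
  have h2 := (hf.hasDerivAt.comp w h1).deriv
  simp only [Function.comp_def] at h2
  rw [eulerOp, eulerOp, h2, Real.rpow_sub_one hw.ne']
  field_simp

lemma betaMean_congr {β : ℝ} {h₁ h₂ : ℝ → ℝ} (h : EqOn h₁ h₂ (Ioi 0)) {τ : ℝ} (hτ : 0 < τ) :
    betaMean β h₁ τ = betaMean β h₂ τ := by
  refine intervalIntegral.integral_congr_ae (ae_of_all _ fun x hx => ?_)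
  rw [uIoc_of_le zero_le_one] at hx
  rw [h (mul_pos hτ hx.1)]

lemma BetaConverges.congr {β : ℝ} {h₁ h₂ : ℝ → ℝ} (hc : BetaConverges β h₁)
    (h : EqOn h₁ h₂ (Ioi 0)) : BetaConverges β h₂ := fun τ hτ => by
  refine (intervalIntegrable_congr fun x hx => ?_).1 (hc τ hτ)
  rw [uIoc_of_le zero_le_one] at hx
  rw [h (mul_pos hτ hx.1)]

lemma betaMean_const_mul {β : ℝ} (c : ℝ) (h : ℝ → ℝ) (τ : ℝ) :
    betaMean β (fun w => c * h w) τ = c * betaMean β h τ := by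
  rw [betaMean, betaMean, ← intervalIntegral.integral_const_mul]
  congr 1 with x
  ring

lemma betaConverges_of_const_mul {β c : ℝ} (hc : c ≠ 0) {h : ℝ → ℝ}
    (hh : BetaConverges β (fun w => c * h w)) : BetaConverges β h := fun τ hτ => by
  have := (hh τ hτ).const_mul c⁻¹
  refine this.congr (fun x _ => ?_)
  simp only
  field_simp

lemma eulerOp_congr {f g : ℝ → ℝ} (h : EqOn f g (Ioi 0)) :
    EqOn (eulerOp f) (eulerOp g) (Ioi 0) := fun t ht => by
  rw [eulerOp, eulerOp, (h.eventuallyEq_of_mem (isOpen_Ioi.mem_nhds ht)).deriv_eq]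

/-! ### Erdélyi–Kober operators on power series -/

lemma intervalIntegrable_one_sub_rpow {β : ℝ} (hβ : 0 < β) :
    IntervalIntegrable (fun x : ℝ => (1 - x) ^ (β - 1)) volume 0 1 := by
  have := (intervalIntegral.intervalIntegrable_rpow' (a := 0) (b := 1)
    (show -1 < β - 1 by linarith)).comp_sub_left 1
  simpa using this.symm

lemma integral_one_sub_rpow_mul_rpow {β q : ℝ} (hβ : 0 < β) (hq : 0 < q) :
    ∫ x in (0 : ℝ)..1, (1 - x) ^ (β - 1) * x ^ (q - 1) =
      Real.Gamma q * Real.Gamma β / Real.Gamma (q + β) := by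
  have h1 := beta_eq_betaIntegralReal q β hq hβ
  rw [beta] at h1
  rw [h1, Complex.betaIntegral]
  have : ∫ x in (0 : ℝ)..1, (x : ℂ) ^ ((q : ℂ) - 1) * (1 - (x : ℂ)) ^ ((β : ℂ) - 1) =
      ((∫ x in (0 : ℝ)..1, (1 - x) ^ (β - 1) * x ^ (q - 1) : ℝ) : ℂ) := by
    rw [← intervalIntegral.integral_ofReal]
    refine intervalIntegral.integral_congr fun x hx => ?_
    rw [uIcc_of_le zero_le_one] at hx
    push_cast
    rw [Complex.ofReal_cpow hx.1, Complex.ofReal_cpow (by linarith [hx.2])]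
    push_cast
    ring
  rw [this, Complex.ofReal_re]

lemma betaConverges_of_continuous {β : ℝ} (hβ : 0 < β) {h : ℝ → ℝ} (hc : Continuous h) :
    BetaConverges β h := fun τ _ =>
  (intervalIntegrable_one_sub_rpow hβ).mul_continuousOn (by fun_prop)

/-- Each power `w ^ (a n)` is multiplied by a beta function. -/
lemma hasSum_betaMean {a β : ℝ} (ha : 0 < a) (hβ : 0 < β) {b : ℕ → ℝ} (hb : EntireCoeff b)
    {τ : ℝ} (hτ : 0 < τ) :
    HasSum (fun n : ℕ => b n * (Real.Gamma (a * n + 1) * Real.Gamma β /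
      Real.Gamma (a * n + 1 + β)) * (τ ^ a) ^ n) (betaMean β (fun w => powSum b (w ^ a)) τ) := by
  have hterm : ∀ n : ℕ, EqOn (fun x : ℝ => (1 - x) ^ (β - 1) * (b n * ((τ * x) ^ a) ^ n))
      (fun x => b n * (τ ^ a) ^ n * ((1 - x) ^ (β - 1) * x ^ ((a * n + 1) - 1))) (Ioc 0 1) := by
    intro n x hx
    simp only [add_sub_cancel_right]
    rw [Real.mul_rpow hτ.le hx.1.le, mul_pow, Real.rpow_mul hx.1.le, Real.rpow_natCast]
    ring
  have hbeta : ∀ n : ℕ, ∀ c : ℝ, ∫ x in Ioc (0 : ℝ) 1,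
      c * (τ ^ a) ^ n * ((1 - x) ^ (β - 1) * x ^ ((a * n + 1) - 1)) =
      c * (Real.Gamma (a * n + 1) * Real.Gamma β / Real.Gamma (a * n + 1 + β)) * (τ ^ a) ^ n := by
    intro n c
    rw [integral_const_mul, ← intervalIntegral.integral_of_le zero_le_one,
      integral_one_sub_rpow_mul_rpow hβ (by positivity)]
    ring
  have hk := (intervalIntegrable_iff_integrableOn_Ioc_of_le zero_le_one).1
    (intervalIntegrable_one_sub_rpow hβ)
  have hint : ∀ n : ℕ, Integrable (fun x : ℝ => (1 - x) ^ (β - 1) * (b n * ((τ * x) ^ a) ^ n))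
      (volume.restrict (Ioc 0 1)) := fun n => by
    have hcont : Continuous fun w : ℝ => b n * (w ^ a) ^ n :=
      continuous_const.mul ((Real.continuous_rpow_const ha.le).pow n)
    exact (intervalIntegrable_iff_integrableOn_Ioc_of_le zero_le_one).1
      (betaConverges_of_continuous hβ hcont τ hτ)
  have hnorm : Summable fun n : ℕ => ∫ x in Ioc (0 : ℝ) 1,
      ‖(1 - x) ^ (β - 1) * (b n * ((τ * x) ^ a) ^ n)‖ := by
    refine Summable.of_nonneg_of_le (fun n => integral_nonneg fun _ => norm_nonneg _) (fun n => ?_)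
      ((hb (τ ^ a)).mul_right (∫ x in Ioc (0 : ℝ) 1, (1 - x) ^ (β - 1)))
    rw [← integral_const_mul]
    refine setIntegral_mono_on (hint n).norm (hk.const_mul _) measurableSet_Ioc fun x hx => ?_
    have h1x : 0 ≤ 1 - x := by linarith [hx.2]
    have hx0 := hx.1
    rw [norm_mul, Real.norm_of_nonneg (by positivity), mul_comm, Real.norm_eq_abs, abs_mul, abs_mul,
      abs_of_nonneg (show 0 ≤ ((τ * x) ^ a) ^ n by positivity),
      abs_of_nonneg (show 0 ≤ (τ ^ a) ^ n by positivity)]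
    gcongr
    nlinarith [hx.2]
  have hsum := hasSum_integral_of_summable_integral_norm hint hnorm
  rw [betaMean, intervalIntegral.integral_of_le zero_le_one]
  convert! hsum using 1
  · ext n
    rw [setIntegral_congr_fun measurableSet_Ioc (hterm n), hbeta]
  · congr 1 with x
    rw [tsum_mul_left, powSum]

lemma ekRec_congr {m η : ℝ} (n : ℕ) {α : ℝ} {f g : ℝ → ℝ} (h : EqOn f g (Ioi 0)) {t : ℝ}
    (ht : 0 < t) : ekRec m η n α f t = ekRec m η n α g t := by
  induction n generalizing α f g with
  | zero =>
    simp only [ekRec]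
    congr 1
    refine intervalIntegral.integral_congr_ae (ae_of_all _ fun u hu => ?_)
    rw [uIoc_of_le ht.le] at hu
    rw [ekIntegrand, ekIntegrand, h hu.1]
  | succ n ih => simp only [ekRec, ih h, ih (eulerOp_congr h)]

lemma EKRecConverges.congr {m η : ℝ} {n : ℕ} {α : ℝ} {f g : ℝ → ℝ}
    (hf : EKRecConverges m η n α f) (h : EqOn f g (Ioi 0)) : EKRecConverges m η n α g := by
  induction n generalizing α f g with
  | zero =>
    intro t ht
    refine (intervalIntegrable_congr fun u hu => ?_).1 (hf t ht)
    rw [uIoc_of_le ht.le] at hu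
    rw [ekIntegrand, ekIntegrand, h hu.1]
  | succ n ih => exact ⟨ih hf.1 h, ih hf.2 (eulerOp_congr h)⟩

lemma eulerOp_powSum_rpow {b : ℕ → ℝ} (hb : EntireCoeff b) (σ : ℝ) :
    EqOn (eulerOp fun t => powSum b (t ^ σ)) (fun t => powSum (fun n => σ * (n * b n)) (t ^ σ))
      (Ioi 0) := fun t ht => by
  have ht0 : (0 : ℝ) < t := ht
  have h1 := ((hb.hasDerivAt_powSum (t ^ σ)).comp t
    (Real.hasDerivAt_rpow_const (p := σ) (Or.inl ht0.ne'))).deriv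
  simp only [Function.comp_def] at h1
  have h2 : powSum (fun n => σ * (n * b n)) (t ^ σ) = σ * powSum (fun n => n * b n) (t ^ σ) := by
    rw [powSum, powSum, ← tsum_mul_left]
    exact tsum_congr fun n => mul_assoc _ _ _
  simp only [eulerOp, h1, h2]
  rw [← hb.mul_powSum_deriv, Real.rpow_sub_one ht0.ne']
  field_simp

/-- The Erdélyi–Kober operator of order `γ` multiplies the power `t ^ (m a n)` by
`Γ(a n + 1) / Γ(a n + 1 + γ)`, whether it is given by the integral or by the recursion. -/
theorem ekRec_powSum {m a : ℝ} (hm : 0 < m) (ha : 0 < a) (N : ℕ) {γ : ℝ} (hγ : 0 < γ + N)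
    {b : ℕ → ℝ} (hb : EntireCoeff b) (hpos : ∀ n : ℕ, b n ≠ 0 → 0 < a * n + 1 + γ) :
    EKRecConverges m 0 N γ (fun t => powSum b (t ^ (m * a))) ∧ ∀ t : ℝ, 0 < t →
      HasSum (fun n : ℕ => b n * (Real.Gamma (a * n + 1) / Real.Gamma (a * n + 1 + γ)) *
        (t ^ (m * a)) ^ n) (ekRec m 0 N γ (fun t => powSum b (t ^ (m * a))) t) := by
  induction N generalizing γ b with
  | zero =>
    rw [Nat.cast_zero, add_zero] at hγ
    have hvar : EqOn (fun w : ℝ => powSum b (w ^ a))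
        (fun w => powSum b ((w ^ (1 / m)) ^ (m * a))) (Ioi 0) := fun w hw => by
      have hw : (0 : ℝ) < w := hw
      simp only
      rw [← Real.rpow_mul hw.le, ← mul_assoc, one_div_mul_cancel hm.ne', one_mul]
    refine ⟨(ekRecConverges_zero_iff hm _).2 (BetaConverges.congr (betaConverges_of_continuous hγ
      (hb.continuous_powSum.comp (Real.continuous_rpow_const ha.le))) hvar), fun t ht => ?_⟩
    have htm : 0 < t ^ m := by positivity
    rw [ekRec_zero_eq_betaMean hm ht, ← betaMean_congr hvar htm, Real.rpow_mul ht.le]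
    refine ((hasSum_betaMean ha hγ hb htm).mul_left (Real.Gamma γ)⁻¹).congr_fun fun n => ?_
    have : Real.Gamma γ ≠ 0 := (Real.Gamma_pos_of_pos hγ).ne'
    field_simp
  | succ N ih =>
    have hγ' : 0 < (γ + 1) + N := by push_cast at hγ; linarith
    have hb' : EntireCoeff fun n : ℕ => m * a * (n * b n) := hb.natCast_mul.const_mul _
    obtain ⟨c1, s1⟩ := ih hγ' hb fun n hn => by linarith [hpos n hn]
    obtain ⟨c2, s2⟩ := ih hγ' hb' fun n hn => by
      linarith [hpos n (right_ne_zero_of_mul (right_ne_zero_of_mul hn))]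
    have he := eulerOp_powSum_rpow hb (m * a)
    refine ⟨⟨c1, c2.congr he.symm⟩, fun t ht => ?_⟩
    simp only [ekRec]
    rw [ekRec_congr N he ht]
    refine (((s1 t ht).mul_left (0 + γ + 1)).add ((s2 t ht).mul_left (1 / m))).congr_fun
      fun n => ?_
    by_cases hbn : b n = 0
    · simp [hbn]
    · have hx := hpos n hbn
      rw [← add_assoc (a * n + 1) γ 1, Real.Gamma_add_one hx.ne']
      field_simp
      ring

/-! ### The Cauchy problem for mixed Poisson probabilities -/

lemma ekSteps_pos (α : ℝ) : 0 < α + ekSteps α := by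
  rw [ekSteps]
  split_ifs with h
  · simpa using h
  · push_cast
    linarith [Nat.lt_floor_add_one (-α)]

lemma mixedCoeff_zero (a : ℝ) (k : ℕ) : mixedCoeff a k 0 = if k = 0 then 1 else 0 := by
  rcases k with _ | k <;> simp [mixedCoeff]

/-- Pascal's rule, in terms of the coefficients. -/
lemma mixedCoeff_pascal {a : ℝ} (ha : 0 < a) (k n : ℕ) :
    mixedCoeff a k (n + 1) * (Real.Gamma (a * ((n + 1 : ℕ) : ℝ) + 1) / Real.Gamma (a * n + 1)) =
      -(mixedCoeff a k n - if k = 0 then 0 else mixedCoeff a (k - 1) n) := by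
  rw [mixedCoeff]
  rcases k with _ | k
  · rw [mixedCoeff]
    simp only [Nat.choose_zero_right, ↓reduceIte]
    field_simp
    ring
  · rw [mixedCoeff, if_neg k.succ_ne_zero, Nat.add_sub_cancel, mixedCoeff, Nat.choose_succ_succ]
    field_simp
    push_cast
    ring

lemma powSum_mul_left (b : ℕ → ℝ) (c s : ℝ) :
    powSum b (c * s) = powSum (fun n => b n * c ^ n) s := by
  rw [powSum, powSum]
  exact tsum_congr fun n => by rw [mul_pow, mul_assoc]

lemma EntireCoeff.sub_apply_zero {b : ℕ → ℝ} (hb : EntireCoeff b) :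
    EntireCoeff (Function.update b 0 0) ∧
      ∀ s, powSum (Function.update b 0 0) s = powSum b s - b 0 := by
  have h : EntireCoeff (Function.update b 0 0) := fun r => by
    refine (summable_nat_add_iff 1).1 (((summable_nat_add_iff 1).2 (hb r)).congr fun n => ?_)
    rw [Function.update_of_ne n.succ_ne_zero]
  refine ⟨h, fun s => ?_⟩
  rw [powSum, powSum, (h s).of_abs.tsum_eq_zero_add, (hb s).of_abs.tsum_eq_zero_add]
  simp

theorem solvesCauchy_of_eq_powSum {H a lam : ℝ} (hH : 0 < H) (ha : 0 < a) {q : ℕ → ℝ → ℝ}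
    (hq : ∀ k t, 0 ≤ t → q k t = powSum (mixedCoeff a k) (lam * t ^ (2 * H * a))) :
    SolvesCauchy H a (lam * (2 * H) ^ a) q := by
  have hm : 0 < 2 * H := by positivity
  set σ := 2 * H * a with hσ
  have hσ0 : 0 < σ := by positivity
  set b : ℕ → ℕ → ℝ := fun k n => mixedCoeff a k n * lam ^ n
  have hb : ∀ k, EntireCoeff (b k) := fun k => (entireCoeff_mixedCoeff ha k).mul_pow lam
  have hqb : ∀ k t, 0 ≤ t → q k t = powSum (b k) (t ^ σ) := fun k t ht => by
    rw [hq k t ht, powSum_mul_left]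
  have hq0 : ∀ k, q k 0 = b k 0 := fun k => by
    rw [hqb k 0 le_rfl, Real.zero_rpow hσ0.ne', powSum_zero]
  have hsub : ∀ k, EqOn (fun t => powSum (Function.update (b k) 0 0) (t ^ σ))
      (fun t => q k t - q k 0) (Ioi 0) := fun k t ht => by
    simp only
    rw [(hb k).sub_apply_zero.2, hq0, hqb k t (le_of_lt ht)]
  have hek := fun k => ekRec_powSum hm ha (ekSteps (-a)) (γ := -a) (ekSteps_pos _)
    (hb k).sub_apply_zero.1 fun n hn => by
      rcases n with _ | n
      · simp at hn
      · push_cast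
        nlinarith [mul_nonneg ha.le n.cast_nonneg (α := ℝ)]
  refine ⟨fun k => ⟨?_, ?_, ?_⟩, fun k t ht => ?_, fun k => ?_⟩
  · have hc : Tendsto (fun t : ℝ => powSum (b k) (t ^ σ)) (𝓝[>] 0) (𝓝 (powSum (b k) (0 ^ σ))) :=
      (((hb k).continuous_powSum.comp (Real.continuous_rpow_const hσ0.le)).tendsto 0).mono_left
        nhdsWithin_le_nhds
    rw [← hqb k 0 le_rfl] at hc
    refine hc.congr' ?_
    filter_upwards [self_mem_nhdsWithin] with t ht using (hqb k t (le_of_lt ht)).symm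
  · refine ContDiffOn.congr (f := fun t => powSum (b k) (t ^ σ)) ?_
      fun t ht => hqb k t (le_of_lt ht)
    exact (hb k).contDiff_powSum.comp_contDiffOn
      (contDiffOn_id.rpow_const_of_ne fun t ht => ne_of_gt ht)
  · rw [sub_sub_cancel]
    exact (hek k).1.congr (hsub k)
  · have hs : 0 < t ^ σ := by positivity
    rw [caputoPow, mcBridePow, sub_sub_cancel, erdelyiKober, ← ekRec_congr _ (hsub k) ht]
    have h1 := (hek k).2 t ht
    rw [← hσ] at h1 ⊢
    rw [← (hasSum_nat_add_iff' 1)] at h1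
    simp only [Finset.range_one, Finset.sum_singleton, Function.update_self, zero_mul,
      sub_zero] at h1
    have h2 : HasSum (fun n => -lam * (b k n - if k = 0 then 0 else b (k - 1) n) * (t ^ σ) ^ n)
        (-lam * (q k t - backShift q k t)) := by
      have h3 := (hb k).hasSum (t ^ σ)
      rw [← hqb k t ht.le] at h3
      rcases k with _ | k
      · simpa [backShift, mul_assoc] using h3.mul_left (-lam)
      · have h4 := (hb k).hasSum (t ^ σ)
        rw [← hqb k t ht.le] at h4
        simpa [backShift, mul_assoc, sub_mul] using (h3.sub h4).mul_left (-lam)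
    have h5 := (h1.mul_left ((t ^ σ)⁻¹)).unique (h2.congr_fun fun n => ?_)
    · rw [Real.rpow_neg ht.le, mul_assoc, h5]
      ring
    · have hp := mixedCoeff_pascal ha k n
      rw [Function.update_of_ne n.succ_ne_zero]
      rw [show a * ((n + 1 : ℕ) : ℝ) + 1 + -a = a * n + 1 by push_cast; ring]
      have : b k (n + 1) * (Real.Gamma (a * ((n + 1 : ℕ) : ℝ) + 1) / Real.Gamma (a * n + 1)) =
          -lam * (b k n - if k = 0 then 0 else b (k - 1) n) := by
        simp only [b]
        rw [mul_right_comm, hp]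
        split_ifs <;> ring
      rw [this, pow_succ]
      field_simp
  · rw [hq0]
    simp only [b, pow_zero, mul_one, mixedCoeff_zero]

/-! ### Membership in McBride's spaces -/

/-- A space of differentiable integrable functions that is stable under `t d/dt` consists of
elements of `F_1`, as `t ^ k f^{(k)}` is a polynomial in `t d/dt` applied to `f`. -/
lemma memF_one_of_eulerOp_stable {S : Submodule ℝ (ℝ → ℝ)}
    (hd : ∀ f ∈ S, ∀ t, 0 < t → DifferentiableAt ℝ f t)
    (hθ : ∀ f ∈ S, ∃ g ∈ S, EqOn (eulerOp f) g (Ioi 0))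
    (hi : ∀ f ∈ S, IntegrableOn f (Ioi 0)) {f : ℝ → ℝ} (hf : f ∈ S) : MemF 1 f := by
  constructor
  · rw [contDiffOn_infty]
    intro n
    induction n generalizing f with
    | zero =>
      exact contDiffOn_zero.2 fun t ht => (hd f hf t ht).continuousAt.continuousWithinAt
    | succ n ih =>
      rw [Nat.cast_add, Nat.cast_one, contDiffOn_succ_iff_deriv_of_isOpen isOpen_Ioi]
      refine ⟨fun t ht => (hd f hf t ht).differentiableWithinAt, by simp, ?_⟩
      obtain ⟨g, hg, hfg⟩ := hθ f hf
      refine ((contDiffOn_id.inv fun t ht => ne_of_gt ht).mul (ih hg)).congr fun t ht => ?_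
      have ht0 : (0 : ℝ) < t := ht
      change deriv f t = t⁻¹ * g t
      rw [← hfg ht, eulerOp, inv_mul_cancel_left₀ ht0.ne']
  · intro k
    have key : ∃ g ∈ S, EqOn (fun t => t ^ k * iteratedDerivWithin k f (Ioi 0) t) g (Ioi 0) := by
      induction k with
      | zero => exact ⟨f, hf, fun t _ => by simp⟩
      | succ k ih =>
        obtain ⟨g, hg, hfg⟩ := ih
        obtain ⟨h, hh, hgh⟩ := hθ g hg
        refine ⟨h - (k : ℝ) • g, S.sub_mem hh (S.smul_mem _ hg), fun t ht => ?_⟩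
        have ht0 : (0 : ℝ) < t := ht
        have h1 : iteratedDerivWithin k f (Ioi 0) =ᶠ[𝓝 t] fun t => (t ^ k)⁻¹ * g t := by
          filter_upwards [isOpen_Ioi.mem_nhds ht] with y hy
          have hy0 : (0 : ℝ) < y := hy
          rw [← hfg hy, inv_mul_cancel_left₀ (pow_pos hy0 k).ne']
        have h2 := (((hasDerivAt_pow k t).inv (pow_pos ht0 k).ne').mul
          (hd g hg t ht).hasDerivAt).congr_of_eventuallyEq h1
        simp only [Pi.sub_apply, Pi.smul_apply, smul_eq_mul, iteratedDerivWithin_succ]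
        rw [derivWithin_of_isOpen isOpen_Ioi ht, h2.deriv, ← hgh ht, eulerOp]
        rcases k with _ | k
        · simp
        · simp only [Nat.add_sub_cancel, Pi.inv_apply]
          field_simp
          ring
    obtain ⟨g, hg, hfg⟩ := key
    rw [ENNReal.ofReal_one, memLp_one_iff_integrable]
    exact (hi g hg).congr_fun hfg.symm measurableSet_Ioi

lemma MemFWeighted.congr {p μ : ℝ} {f g : ℝ → ℝ} (hf : MemFWeighted p μ f)
    (h : EqOn f g (Ioi 0)) : MemFWeighted p μ g := by
  have h' : EqOn (fun t => t ^ (-μ) * g t) (fun t => t ^ (-μ) * f t) (Ioi 0) := fun t ht => by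
    simp only
    rw [h ht]
  refine ⟨hf.1.congr h', fun k => (hf.2 k).ae_eq ?_⟩
  filter_upwards [ae_restrict_mem measurableSet_Ioi] with t ht
  rw [iteratedDerivWithin_congr h' ht]

/-- The increments `ψₖ(s) - ψₖ(0)` of the mixed Poisson probabilities. -/
noncomputable def mixedIncrement (μ : Measure ℝ) (k : ℕ) (s : ℝ) : ℝ :=
  mixedPoisson μ k s - if k = 0 then 1 else 0

lemma hasDerivAt_mixedIncrement (μ : Measure ℝ) [IsFiniteMeasure μ] (k : ℕ) {s : ℝ} (hs : 0 < s) :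
    HasDerivAt (mixedIncrement μ k)
      ((k * mixedIncrement μ k s - (k + 1) * mixedIncrement μ (k + 1) s) / s) s := by
  refine ((hasDerivAt_mixedPoisson μ k hs).sub_const (if k = 0 then 1 else 0)).congr_deriv ?_
  rcases k with _ | k <;> simp [mixedIncrement]

lemma abs_mixedIncrement_le_one (μ : Measure ℝ) [IsProbabilityMeasure μ] (k : ℕ) {s : ℝ}
    (hs : 0 ≤ s) : |mixedIncrement μ k s| ≤ 1 := by
  have h0 := mixedPoisson_nonneg μ k hs
  have h1 := mixedPoisson_le_one μ k hs
  rw [mixedIncrement, abs_le]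
  split_ifs <;> constructor <;> linarith

lemma exists_abs_mixedIncrement_le {a : ℝ} (ha : 0 < a) (μ : Measure ℝ) [IsProbabilityMeasure μ]
    (hμ : ∀ s, 0 ≤ s → ∫ x, Real.exp (-(s * |x|)) ∂μ = mittagLeffler a 1 (-s)) (k : ℕ) :
    ∃ C, 0 ≤ C ∧ ∀ s, 0 ≤ s → |mixedIncrement μ k s| ≤ C * s := by
  -- the mean value inequality on `[0,1]`, and the bound by `1` beyond
  have hb := entireCoeff_mixedCoeff ha k
  obtain ⟨C, hC⟩ := isCompact_Icc.exists_bound_of_continuousOn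
    (hb.deriv.continuous_powSum.continuousOn (s := Icc (0 : ℝ) 1))
  have hC0 : 0 ≤ C := (norm_nonneg _).trans (hC 0 ⟨le_rfl, zero_le_one⟩)
  refine ⟨C + 1, by linarith, fun s hs => ?_⟩
  rcases le_total s 1 with h1 | h1
  · have := Convex.norm_image_sub_le_of_norm_hasDerivWithin_le (f := powSum (mixedCoeff a k))
      (fun x _ => (hb.hasDerivAt_powSum x).hasDerivWithinAt) hC (convex_Icc 0 1)
      (left_mem_Icc.2 zero_le_one) ⟨hs, h1⟩
    rw [powSum_zero, mixedCoeff_zero, ← mixedPoisson_eq_powSum ha μ hμ k hs, sub_zero,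
      Real.norm_eq_abs, Real.norm_of_nonneg hs] at this
    rw [mixedIncrement]
    linarith
  · have := abs_mixedIncrement_le_one μ k hs
    nlinarith

/-- The increments are `O(t ^ σ)` at `0` and bounded, so the weight `t ^ (-1 - σ / 2)` makes them
integrable both at `0` and at infinity. The recursion `s ψₖ' = k ψₖ - (k + 1) ψₖ₊₁` shows that the
span of the weighted increments is stable under `t d/dt`, which takes care of the derivatives. -/
theorem memFWeighted_mixedIncrement {a lam σ : ℝ} (ha : 0 < a) (hlam : 0 < lam) (hσ : 0 < σ)
    (μ : Measure ℝ) [IsProbabilityMeasure μ]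
    (hμ : ∀ s, 0 ≤ s → ∫ x, Real.exp (-(s * |x|)) ∂μ = mittagLeffler a 1 (-s)) (k : ℕ) :
    MemFWeighted 1 (1 + σ / 2) (fun t => mixedIncrement μ k (lam * t ^ σ)) := by
  set w := 1 + σ / 2 with hw
  set g : ℕ → ℝ → ℝ := fun k t => t ^ (-w) * mixedIncrement μ k (lam * t ^ σ) with hg
  have hgd : ∀ k t, 0 < t → HasDerivAt (g k)
      ((-w * g k t + σ * (k * g k t - (k + 1) * g (k + 1) t)) / t) t := by
    intro k t ht
    have hs : 0 < lam * t ^ σ := by positivity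
    have h1 := (Real.hasDerivAt_rpow_const (p := σ) (Or.inl ht.ne')).const_mul lam
    have h2 := (hasDerivAt_mixedIncrement μ k hs).comp t h1
    have h3 := (Real.hasDerivAt_rpow_const (p := -w) (Or.inl ht.ne')).mul h2
    refine h3.congr_deriv ?_
    simp only [hg, Function.comp_apply, Real.rpow_sub_one ht.ne']
    field_simp
  have hgi : ∀ k, IntegrableOn (g k) (Ioi 0) := by
    intro k
    have hcont : ContinuousOn (g k) (Ioi 0) := fun t ht =>
      (hgd k t ht).continuousAt.continuousWithinAt
    rw [← Ioc_union_Ioi_eq_Ioi zero_le_one]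
    refine IntegrableOn.union ?_ ?_
    · obtain ⟨C, hC0, hC⟩ := exists_abs_mixedIncrement_le ha μ hμ k
      have hdom : IntegrableOn (fun t : ℝ => C * lam * t ^ (σ / 2 - 1)) (Ioc 0 1) :=
        ((intervalIntegrable_iff_integrableOn_Ioc_of_le zero_le_one).1
          (intervalIntegral.intervalIntegrable_rpow' (by linarith))).const_mul _
      refine hdom.mono' ((hcont.mono Ioc_subset_Ioi_self).aestronglyMeasurable measurableSet_Ioc) ?_
      filter_upwards [ae_restrict_mem measurableSet_Ioc] with t ht
      have ht0 := ht.1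
      have hpow : t ^ (σ / 2 - 1) = t ^ (-w) * t ^ σ := by
        rw [← Real.rpow_add ht0]
        congr 1
        rw [hw]
        ring
      rw [norm_mul, Real.norm_of_nonneg (by positivity), hpow]
      calc _ ≤ t ^ (-w) * (C * (lam * t ^ σ)) := by
            gcongr
            exact hC _ (by positivity)
        _ = _ := by ring
    · refine (integrableOn_Ioi_rpow_of_lt (show -w < -1 by rw [hw]; linarith) one_pos).mono'
        ((hcont.mono (Ioi_subset_Ioi zero_le_one)).aestronglyMeasurable measurableSet_Ioi) ?_
      filter_upwards [ae_restrict_mem measurableSet_Ioi] with t ht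
      have ht0 : (0 : ℝ) < t := zero_lt_one.trans ht
      rw [norm_mul, Real.norm_of_nonneg (by positivity)]
      exact mul_le_of_le_one_right (by positivity) (abs_mixedIncrement_le_one μ k (by positivity))
  have hgS : ∀ k, g k ∈ Submodule.span ℝ (range g) := fun k => Submodule.subset_span ⟨k, rfl⟩
  have hd : ∀ f ∈ Submodule.span ℝ (range g), ∀ t, 0 < t → DifferentiableAt ℝ f t := by
    intro f hf t ht
    induction hf using Submodule.span_induction with
    | mem f hf => obtain ⟨k, rfl⟩ := hf; exact (hgd k t ht).differentiableAt
    | zero => exact differentiableAt_const _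
    | add f₁ f₂ _ _ h₁ h₂ => exact h₁.add h₂
    | smul c f _ h => exact h.const_smul c
  refine memF_one_of_eulerOp_stable hd (fun f hf => ?_) (fun f hf => ?_) (hgS k)
  · induction hf using Submodule.span_induction with
    | mem f hf =>
      obtain ⟨k, rfl⟩ := hf
      refine ⟨(-w) • g k + σ • ((k : ℝ) • g k - ((k : ℝ) + 1) • g (k + 1)),
        Submodule.add_mem _ (Submodule.smul_mem _ _ (hgS k)) (Submodule.smul_mem _ _
          (Submodule.sub_mem _ (Submodule.smul_mem _ _ (hgS k))
            (Submodule.smul_mem _ _ (hgS (k + 1))))), fun t ht => ?_⟩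
      rw [eulerOp, (hgd k t ht).deriv, mul_div_cancel₀ _ (ne_of_gt ht)]
      simp only [Pi.add_apply, Pi.smul_apply, Pi.sub_apply, smul_eq_mul]
    | zero => exact ⟨0, Submodule.zero_mem _, fun t _ => by simp [eulerOp]⟩
    | add f₁ f₂ hf₁ hf₂ h₁ h₂ =>
      obtain ⟨g₁, hg₁, h₁⟩ := h₁
      obtain ⟨g₂, hg₂, h₂⟩ := h₂
      refine ⟨g₁ + g₂, Submodule.add_mem _ hg₁ hg₂, fun t ht => ?_⟩
      rw [eulerOp, deriv_add (hd f₁ hf₁ t ht) (hd f₂ hf₂ t ht), mul_add, Pi.add_apply, ← h₁ ht,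
        ← h₂ ht, eulerOp, eulerOp]
    | smul c f hf h =>
      obtain ⟨g, hg, h⟩ := h
      refine ⟨c • g, Submodule.smul_mem _ _ hg, fun t ht => ?_⟩
      rw [eulerOp, deriv_const_smul _ (hd f hf t ht), Pi.smul_apply, ← h ht, eulerOp, smul_eq_mul,
        smul_eq_mul]
      ring
  · induction hf using Submodule.span_induction with
    | mem f hf => obtain ⟨k, rfl⟩ := hf; exact hgi k
    | zero => exact integrableOn_zero
    | add f₁ f₂ _ _ h₁ h₂ => exact h₁.add h₂
    | smul c f _ h => exact h.smul c

/-! ### Differentiating the Erdélyi–Kober integral -/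

lemma intervalIntegrable_of_betaConverges {β : ℝ} {h : ℝ → ℝ} (hh : BetaConverges β h) {T : ℝ}
    (hT : 0 < T) : IntervalIntegrable h volume 0 T := by
  have h1 : IntervalIntegrable (fun x => (1 - x) ^ (β - 1) * h (2 * T * x)) volume 0 (1 / 2) :=
    (hh (2 * T) (by positivity)).mono_set (by
      rw [uIcc_of_le (by norm_num), uIcc_of_le (by norm_num)]
      exact Icc_subset_Icc_right (by norm_num))
  have hpos : ∀ x ∈ uIcc (0 : ℝ) (1 / 2), 0 < 1 - x := fun x hx => by
    rw [uIcc_of_le (by norm_num)] at hx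
    linarith [hx.2]
  have h2 : IntervalIntegrable (fun x => h (2 * T * x)) volume 0 (1 / 2) := by
    refine (h1.continuousOn_mul (g := fun x => (1 - x) ^ (1 - β)) ?_).congr fun x hx => ?_
    · exact ContinuousOn.rpow_const (by fun_prop) fun x hx => Or.inl (hpos x hx).ne'
    · have := hpos x (uIoc_subset_uIcc hx)
      rw [← mul_assoc, ← Real.rpow_add this]
      simp
  have h3 := IntervalIntegrable.comp_mul_left_iff (a := 0) (b := T) (f := h)
    (show 2 * T ≠ 0 by positivity)
  rw [zero_div, show T / (2 * T) = 1 / 2 by field_simp] at h3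
  exact h3.1 h2

/-- Fubini's theorem for the derivative of `betaMean β y`, on the rectangle `(0,1) × (ε,T)`. Near
`x = 1` the derivative of `y` is bounded and near `x = 0` the kernel is. -/
lemma betaMean_sub_eq_integral {β : ℝ} (hβ : 0 < β) {y : ℝ → ℝ}
    (hd : ∀ t, 0 < t → DifferentiableAt ℝ y t) (hdc : ContinuousOn (deriv y) (Ioi 0))
    (hy : BetaConverges β y) (hey : BetaConverges β (eulerOp y)) {ε T : ℝ} (hε : 0 < ε)
    (hεT : ε ≤ T) :
    betaMean β y T - betaMean β y ε = ∫ s in ε..T, betaMean β (eulerOp y) s / s := by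
  have hT : 0 < T := hε.trans_le hεT
  set G : ℝ × ℝ → ℝ := fun p => (1 - p.1) ^ (β - 1) * (p.1 * deriv y (p.2 * p.1)) with hG
  have hGe : ∀ x s : ℝ, 0 < s → G (x, s) = s⁻¹ * ((1 - x) ^ (β - 1) * eulerOp y (s * x)) := by
    intro x s hs
    simp only [hG, eulerOp]
    field_simp
  have hdm : Measurable (deriv y) := measurable_deriv y
  have hGm : Measurable G := by
    have h1 : Measurable fun p : ℝ × ℝ => deriv y (p.2 * p.1) := hdm.comp (by fun_prop)
    have h2 : Measurable fun p : ℝ × ℝ => (1 - p.1) ^ (β - 1) :=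
      (measurable_const.sub measurable_fst).pow_const _
    exact h2.mul (measurable_fst.mul h1)
  have hGx : ∀ s, 0 < s → IntegrableOn (fun x => G (x, s)) (Ioc 0 1) := fun s hs => by
    simp only [hGe _ s hs]
    exact ((intervalIntegrable_iff_integrableOn_Ioc_of_le zero_le_one).1 (hey s hs)).const_mul _
  have hk := (intervalIntegrable_iff_integrableOn_Ioc_of_le zero_le_one).1
    (intervalIntegrable_one_sub_rpow hβ)
  have heT := (intervalIntegrable_iff_integrableOn_Ioc_of_le hT.le).1
    (intervalIntegrable_of_betaConverges hey hT)
  have hec : ContinuousOn (eulerOp y) (Ioi 0) := continuousOn_id.mul hdc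
  obtain ⟨M, hM⟩ := isCompact_Icc.exists_bound_of_continuousOn
    (hec.mono (fun w hw => (half_pos hε).trans_le hw.1 : Icc (ε / 2) T ⊆ Ioi 0))
  have hM0 : 0 ≤ M := (norm_nonneg _).trans (hM T ⟨by linarith, le_rfl⟩)
  have hkc : ContinuousOn (fun x : ℝ => (1 - x) ^ (β - 1)) (Icc 0 (1 / 2)) :=
    ContinuousOn.rpow_const (by fun_prop) fun x hx => Or.inl (by linarith [hx.2])
  obtain ⟨K, hK⟩ := isCompact_Icc.exists_bound_of_continuousOn hkc
  have hK0 : 0 ≤ K := (norm_nonneg _).trans (hK 0 ⟨le_rfl, by norm_num⟩)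
  have hbound : ∀ s ∈ Ioc ε T, ∫ x in Ioc (0 : ℝ) 1, ‖G (x, s)‖ ≤
      ε⁻¹ * (M * (∫ x in Ioc (0 : ℝ) 1, (1 - x) ^ (β - 1)) +
        K * (ε⁻¹ * ∫ w in Ioc 0 T, ‖eulerOp y w‖)) := by
    intro s hs
    have hs0 : 0 < s := hε.trans hs.1
    have hsx : IntegrableOn (fun x => ‖eulerOp y (s * x)‖) (Ioc 0 1) := by
      have h3 := IntervalIntegrable.comp_mul_left_iff (a := 0) (b := s)
        (f := fun w => ‖eulerOp y w‖) hs0.ne'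
      rw [zero_div, div_self hs0.ne'] at h3
      exact (intervalIntegrable_iff_integrableOn_Ioc_of_le zero_le_one).1
        (h3.2 (intervalIntegrable_of_betaConverges hey hs0).norm)
    have hsx_le : ∫ x in Ioc (0 : ℝ) 1, ‖eulerOp y (s * x)‖ ≤
        ε⁻¹ * ∫ w in Ioc 0 T, ‖eulerOp y w‖ := by
      have h1 := intervalIntegral.integral_comp_mul_left (a := 0) (b := 1)
        (fun w => ‖eulerOp y w‖) hs0.ne'
      rw [mul_zero, mul_one, smul_eq_mul, intervalIntegral.integral_of_le zero_le_one,
        intervalIntegral.integral_of_le hs0.le] at h1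
      rw [h1]
      have h2 : ∫ w in Ioc 0 s, ‖eulerOp y w‖ ≤ ∫ w in Ioc 0 T, ‖eulerOp y w‖ :=
        setIntegral_mono_set heT.norm (ae_of_all _ fun _ => norm_nonneg _)
          (Ioc_subset_Ioc_right hs.2).eventuallyLE
      have h3 : 0 ≤ ∫ w in Ioc 0 s, ‖eulerOp y w‖ := integral_nonneg fun _ => norm_nonneg _
      gcongr
      exact hs.1.le
    calc ∫ x in Ioc (0 : ℝ) 1, ‖G (x, s)‖
        ≤ ∫ x in Ioc (0 : ℝ) 1, ε⁻¹ * (M * (1 - x) ^ (β - 1) + K * ‖eulerOp y (s * x)‖) := by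
          refine setIntegral_mono_on (hGx s hs0).norm
            (((hk.const_mul M).add (hsx.const_mul K)).const_mul _) measurableSet_Ioc fun x hx => ?_
          have h1x : 0 ≤ 1 - x := by linarith [hx.2]
          have hkx : 0 ≤ (1 - x) ^ (β - 1) := by positivity
          rw [hGe x s hs0, norm_mul, norm_mul, norm_inv, Real.norm_of_nonneg hs0.le,
            Real.norm_of_nonneg hkx]
          have hcase : (1 - x) ^ (β - 1) * ‖eulerOp y (s * x)‖ ≤
              M * (1 - x) ^ (β - 1) + K * ‖eulerOp y (s * x)‖ := by
            rcases le_total x (1 / 2) with h | h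
            · have h1 := hK x ⟨hx.1.le, h⟩
              rw [Real.norm_of_nonneg hkx] at h1
              have := mul_le_mul_of_nonneg_right h1 (norm_nonneg (eulerOp y (s * x)))
              have := mul_nonneg hM0 hkx
              linarith
            · have h1 := hM (s * x) ⟨by nlinarith [hs.1], by nlinarith [hs.2, hx.2]⟩
              have := mul_le_mul_of_nonneg_left h1 hkx
              have := mul_nonneg hK0 (norm_nonneg (eulerOp y (s * x)))
              linarith
          gcongr
          exact hs.1.le
      _ = ε⁻¹ * (M * (∫ x in Ioc (0 : ℝ) 1, (1 - x) ^ (β - 1)) +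
            K * ∫ x in Ioc (0 : ℝ) 1, ‖eulerOp y (s * x)‖) := by
          rw [integral_const_mul, integral_add (hk.const_mul M) (hsx.const_mul K),
            integral_const_mul, integral_const_mul]
      _ ≤ _ := by gcongr
  have hprod : Integrable G
      ((volume.restrict (Ioc (0 : ℝ) 1)).prod (volume.restrict (Ioc ε T))) := by
    rw [integrable_prod_iff' hGm.aestronglyMeasurable]
    refine ⟨?_, ?_⟩
    · filter_upwards [ae_restrict_mem measurableSet_Ioc] with s hs using hGx s (hε.trans hs.1)
    · refine (integrable_const (ε⁻¹ * (M * (∫ x in Ioc (0 : ℝ) 1, (1 - x) ^ (β - 1)) +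
        K * (ε⁻¹ * ∫ w in Ioc 0 T, ‖eulerOp y w‖)))).mono' ?_ ?_
      · exact hGm.norm.stronglyMeasurable.integral_prod_left'.aestronglyMeasurable
      · filter_upwards [ae_restrict_mem measurableSet_Ioc] with s hs
        rw [Real.norm_of_nonneg (integral_nonneg fun _ => norm_nonneg _)]
        exact hbound s hs
  have hswap := integral_integral_swap (f := fun x s => G (x, s)) hprod
  rw [betaMean, betaMean, ← intervalIntegral.integral_sub (hy T hT) (hy ε hε),
    intervalIntegral.integral_of_le zero_le_one, intervalIntegral.integral_of_le hεT]
  refine Eq.trans ?_ (hswap.trans ?_)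
  · refine setIntegral_congr_fun measurableSet_Ioc fun x hx => ?_
    have hx0 := hx.1
    have hsub : ∀ s ∈ uIcc ε T, 0 < s * x := fun s hs => by
      rw [uIcc_of_le hεT] at hs
      exact mul_pos (hε.trans_le hs.1) hx0
    have hftc : ∫ s in ε..T, x * deriv y (s * x) = y (T * x) - y (ε * x) := by
      refine intervalIntegral.integral_eq_sub_of_hasDerivAt (f := fun s => y (s * x))
        (fun s hs => ?_) ?_
      · have h1 := (hd _ (hsub s hs)).hasDerivAt.comp s ((hasDerivAt_id s).mul_const x)
        refine h1.congr_deriv ?_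
        ring
      · refine ContinuousOn.intervalIntegrable (continuousOn_const.mul
          (hdc.comp (by fun_prop) fun s hs => hsub s hs))
    simp only [hG]
    rw [← mul_sub, ← hftc, ← intervalIntegral.integral_of_le hεT,
      ← intervalIntegral.integral_const_mul]
  · refine setIntegral_congr_fun measurableSet_Ioc fun s hs => ?_
    simp only [hGe _ s (hε.trans hs.1)]
    rw [integral_const_mul, ← intervalIntegral.integral_of_le zero_le_one, betaMean]
    ring

/-- Differentiation under the integral sign without a bound on the derivative of `y` near `0`: the
continuity of `betaMean β (eulerOp y)`, which the equation of the Cauchy problem supplies, takes the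
place of a dominating function. -/
lemma hasDerivAt_betaMean {β : ℝ} (hβ : 0 < β) {y : ℝ → ℝ}
    (hd : ∀ t, 0 < t → DifferentiableAt ℝ y t) (hdc : ContinuousOn (deriv y) (Ioi 0))
    (hy : BetaConverges β y) (hey : BetaConverges β (eulerOp y))
    (hr : ContinuousOn (betaMean β (eulerOp y)) (Ioi 0)) {τ : ℝ} (hτ : 0 < τ) :
    HasDerivAt (betaMean β y) (betaMean β (eulerOp y) τ / τ) τ := by
  have hrc : ContinuousOn (fun s => betaMean β (eulerOp y) s / s) (Ioi 0) :=
    hr.div continuousOn_id fun s hs => ne_of_gt hs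
  have h1 : HasDerivAt (fun T => betaMean β y (τ / 2) +
      ∫ s in (τ / 2)..T, betaMean β (eulerOp y) s / s) (betaMean β (eulerOp y) τ / τ) τ := by
    refine HasDerivAt.const_add _ (intervalIntegral.integral_hasDerivAt_right ?_ ?_ ?_)
    · refine ContinuousOn.intervalIntegrable (hrc.mono fun s hs => ?_)
      rw [uIcc_of_le (by linarith)] at hs
      exact (half_pos hτ).trans_le hs.1
    · exact hrc.stronglyMeasurableAtFilter isOpen_Ioi τ hτ
    · exact hrc.continuousAt (isOpen_Ioi.mem_nhds hτ)
  refine h1.congr_of_eventuallyEq ?_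
  filter_upwards [eventually_gt_nhds (show τ / 2 < τ by linarith)] with T hT
  rw [← betaMean_sub_eq_integral hβ hd hdc hy hey (half_pos hτ) hT.le]
  ring

/-! ### The Laplace transform of the Caputo-like power -/

lemma integrableOn_exp_neg_mul_mul {z B : ℝ} (hz : 0 < z) {f : ℝ → ℝ} (hf : ContinuousOn f (Ioi 0))
    (hB : ∀ t, 0 < t → |f t| ≤ B) : IntegrableOn (fun t => Real.exp (-(z * t)) * f t) (Ioi 0) := by
  refine Integrable.mul_bdd (c := B) (integrableOn_exp_neg_mul hz)
    (hf.aestronglyMeasurable measurableSet_Ioi) ?_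
  filter_upwards [ae_restrict_mem measurableSet_Ioi] with t ht using hB t ht

/-- Integration by parts for the Laplace transform. -/
lemma laplace_of_hasDerivAt {W W' : ℝ → ℝ} (hd : ∀ τ, 0 < τ → HasDerivAt W (W' τ) τ)
    (h0 : Tendsto W (𝓝[>] 0) (𝓝 0)) {C : ℝ} (hC : ∀ τ, 0 < τ → |W τ| ≤ C * (1 + τ))
    (hc : ContinuousOn W' (Ioi 0)) {B : ℝ} (hB : ∀ τ, 0 < τ → |W' τ| ≤ B) {z : ℝ} (hz : 0 < z) :
    z * ∫ τ in Ioi 0, Real.exp (-(z * τ)) * W τ = ∫ τ in Ioi 0, Real.exp (-(z * τ)) * W' τ := by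
  have hWc : ContinuousOn W (Ioi 0) := fun τ hτ => (hd τ hτ).continuousAt.continuousWithinAt
  have hlin : IntegrableOn (fun t : ℝ => t * Real.exp (-(z * t))) (Ioi 0) := by
    have h := Real.integral_rpow_mul_exp_neg_mul_Ioi (a := 2) two_pos hz
    have h2 : (2 : ℝ) - 1 = 1 := by norm_num
    simp only [h2, Real.rpow_one] at h
    refine Integrable.of_integral_ne_zero ?_
    rw [h]
    have := Real.Gamma_pos_of_pos (two_pos (α := ℝ))
    positivity
  have hWi : IntegrableOn (fun τ => Real.exp (-(z * τ)) * W τ) (Ioi 0) := by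
    refine (((integrableOn_exp_neg_mul hz).add hlin).const_mul C).mono'
      ((ContinuousOn.mul (by fun_prop) hWc).aestronglyMeasurable measurableSet_Ioi) ?_
    filter_upwards [ae_restrict_mem measurableSet_Ioi] with t ht
    rw [norm_mul, Real.norm_of_nonneg (Real.exp_pos _).le, Pi.add_apply]
    calc _ ≤ Real.exp (-(z * t)) * (C * (1 + t)) := by gcongr; exact hC t ht
      _ = _ := by ring
  have hW'i := integrableOn_exp_neg_mul_mul hz hc hB
  have hdu : ∀ τ, 0 < τ → HasDerivAt (fun τ => Real.exp (-(z * τ)) * W τ)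
      (-z * (Real.exp (-(z * τ)) * W τ) + Real.exp (-(z * τ)) * W' τ) τ := fun τ hτ => by
    have h1 : HasDerivAt (fun τ => Real.exp (-(z * τ))) (Real.exp (-(z * τ)) * -z) τ :=
      (((hasDerivAt_id τ).const_mul z).neg.exp).congr_deriv (by simp)
    exact (h1.mul (hd τ hτ)).congr_deriv (by ring)
  have hdi : IntegrableOn (fun τ => -z * (Real.exp (-(z * τ)) * W τ) +
      Real.exp (-(z * τ)) * W' τ) (Ioi 0) := (hWi.const_mul _).add hW'i
  have hinf := tendsto_zero_of_hasDerivAt_of_integrableOn_Ioi hdu hdi hWi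
  have hzero : Tendsto (fun τ => Real.exp (-(z * τ)) * W τ) (𝓝[>] 0) (𝓝 0) := by
    have h1 : Tendsto (fun τ : ℝ => Real.exp (-(z * τ))) (𝓝[>] 0) (𝓝 1) := by
      have : Tendsto (fun τ : ℝ => Real.exp (-(z * τ))) (𝓝 0) (𝓝 (Real.exp (-(z * 0)))) :=
        Continuous.tendsto (by fun_prop) 0
      rw [mul_zero, neg_zero, Real.exp_zero] at this
      exact this.mono_left nhdsWithin_le_nhds
    simpa using h1.mul h0
  have hparts := integral_Ioi_of_hasDerivAt_of_tendsto (a := 0)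
    (f := Function.update (fun τ => Real.exp (-(z * τ)) * W τ) 0 0) (m := 0) ?_
    (fun τ hτ => ?_) hdi ?_
  · rw [integral_add (hWi.const_mul _) hW'i, integral_const_mul, Function.update_self] at hparts
    linarith
  · refine (continuousWithinAt_Ioi_iff_Ici.1 ?_)
    refine continuousWithinAt_update_same.2 ?_
    simpa using hzero
  · refine (hdu τ hτ).congr_of_eventuallyEq ?_
    filter_upwards [isOpen_Ioi.mem_nhds hτ] with y hy
    exact Function.update_of_ne (ne_of_gt hy) _ _
  · refine hinf.congr' ?_
    filter_upwards [eventually_gt_atTop 0] with y hy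
    rw [Function.update_of_ne (ne_of_gt hy)]

/-- The Laplace transform turns the convolution with `τ ^ (β - 1)` into multiplication by
`Γ(β) z ^ (-β)`. -/
lemma laplace_integral_sub_rpow_mul {β z B : ℝ} (hβ : 0 < β) (hz : 0 < z) {h : ℝ → ℝ}
    (hc : ContinuousOn h (Ioi 0)) (hB : ∀ t, 0 < t → |h t| ≤ B) :
    ∫ τ in Ioi 0, Real.exp (-(z * τ)) * ∫ w in (0 : ℝ)..τ, (τ - w) ^ (β - 1) * h w =
      Real.Gamma β / z ^ β * ∫ τ in Ioi 0, Real.exp (-(z * τ)) * h τ := by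
  have hG := Real.integral_rpow_mul_exp_neg_mul_Ioi hβ hz
  have hGpos := Real.Gamma_pos_of_pos hβ
  have hk : IntegrableOn (fun s : ℝ => s ^ (β - 1) * Real.exp (-(z * s))) (Ioi 0) := by
    refine Integrable.of_integral_ne_zero ?_
    rw [hG]
    positivity
  have h1 := integral_posConvolution (integrableOn_exp_neg_mul_mul hz hc hB) hk
    (ContinuousLinearMap.mul ℝ ℝ)
  simp only [ContinuousLinearMap.mul_apply'] at h1
  rw [hG] at h1
  have h2 : ∫ τ in Ioi 0, Real.exp (-(z * τ)) * ∫ w in (0 : ℝ)..τ, (τ - w) ^ (β - 1) * h w =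
      ∫ x in Ioi 0, ∫ t in (0 : ℝ)..x, Real.exp (-(z * t)) * h t *
        ((x - t) ^ (β - 1) * Real.exp (-(z * (x - t)))) := by
    congr 1 with τ
    rw [← intervalIntegral.integral_const_mul]
    congr 1 with w
    rw [show -(z * τ) = -(z * w) + -(z * (τ - w)) by ring, Real.exp_add]
    ring
  rw [h2, h1, Real.div_rpow zero_le_one hz.le, Real.one_rpow]
  ring

lemma abs_betaMean_le {β B : ℝ} (hβ : 0 < β) {h : ℝ → ℝ} (hB : ∀ t, 0 < t → |h t| ≤ B) {τ : ℝ}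
    (hτ : 0 < τ) : |betaMean β h τ| ≤ B * ∫ x in (0 : ℝ)..1, (1 - x) ^ (β - 1) := by
  rw [← intervalIntegral.integral_const_mul, ← Real.norm_eq_abs, betaMean]
  refine intervalIntegral.norm_integral_le_of_norm_le zero_le_one
    (ae_of_all _ fun x hx => ?_) ((intervalIntegrable_one_sub_rpow hβ).const_mul B)
  have h1x : 0 ≤ 1 - x := by linarith [hx.2]
  rw [norm_mul, Real.norm_of_nonneg (by positivity), mul_comm]
  gcongr
  exact hB _ (mul_pos hτ hx.1)

lemma continuousOn_betaMean {β B : ℝ} (hβ : 0 < β) {h : ℝ → ℝ} (hc : ContinuousOn h (Ioi 0))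
    (hB : ∀ t, 0 < t → |h t| ≤ B) : ContinuousOn (betaMean β h) (Ioi 0) := by
  have hkm : Measurable fun x : ℝ => (1 - x) ^ (β - 1) :=
    (measurable_const.sub measurable_id).pow_const _
  have hmaps : ∀ τ : ℝ, 0 < τ → ∀ x ∈ Ioc (0 : ℝ) 1, τ * x ∈ Ioi (0 : ℝ) :=
    fun τ hτ x hx => mul_pos hτ hx.1
  have : betaMean β h = fun τ => ∫ x in Ioc (0 : ℝ) 1, (1 - x) ^ (β - 1) * h (τ * x) :=
    funext fun τ => intervalIntegral.integral_of_le zero_le_one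
  rw [this]
  refine continuousOn_of_dominated (bound := fun x => B * (1 - x) ^ (β - 1)) (fun τ hτ => ?_)
    (fun τ hτ => ?_) ?_ ?_
  · exact hkm.aestronglyMeasurable.mul
      ((hc.comp (by fun_prop) (hmaps τ hτ)).aestronglyMeasurable measurableSet_Ioc)
  · filter_upwards [ae_restrict_mem measurableSet_Ioc] with x hx
    have h1x : 0 ≤ 1 - x := by linarith [hx.2]
    rw [norm_mul, Real.norm_of_nonneg (by positivity), mul_comm]
    gcongr
    exact hB _ (hmaps τ hτ x hx)
  · exact ((intervalIntegrable_iff_integrableOn_Ioc_of_le zero_le_one).1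
      (intervalIntegrable_one_sub_rpow hβ)).const_mul B
  · filter_upwards [ae_restrict_mem measurableSet_Ioc] with x hx
    exact continuousOn_const.mul (hc.comp (by fun_prop) fun τ hτ => hmaps τ hτ x hx)

lemma contDiffOn_deriv {h : ℝ → ℝ} (hs : ContDiffOn ℝ (⊤ : ℕ∞) h (Ioi 0)) :
    ContDiffOn ℝ (⊤ : ℕ∞) (deriv h) (Ioi 0) :=
  ((contDiffOn_infty_iff_deriv_of_isOpen isOpen_Ioi).1 hs).2

/-- For `0 < a < 1`, the equation `ᶜL^a f = -κ g` says that the fractional integral of order `1 - a`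
of `h(w) = f(w^{1/m}) - f(0)` is differentiable, with derivative proportional to `g(w^{1/m})`. -/
lemma hasDerivAt_of_caputoPow_lt_one {m a κ B : ℝ} (hm : 0 < m) (ha : 0 < a) (ha1 : a < 1)
    {f g : ℝ → ℝ} (hf : CaputoDomain (1 - m) a f) (hB : ∀ t, 0 < t → |f t - f 0| ≤ B)
    (hg : ContinuousOn g (Ioi 0))
    (heq : ∀ t, 0 < t → caputoPow (1 - m) a f t = -κ * g t) {τ : ℝ} (hτ : 0 < τ) :
    HasDerivAt (fun τ => τ ^ (1 - a) * betaMean (1 - a) (fun w => f (w ^ (1 / m)) - f 0) τ)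
      (-(κ * Real.Gamma (1 - a) / m ^ a) * g (τ ^ (1 / m))) τ := by
  set β := 1 - a with hβdef
  have hβ : 0 < β := by linarith
  set h : ℝ → ℝ := fun w => f (w ^ (1 / m)) - f 0
  have hpow : ∀ w ∈ Ioi (0 : ℝ), w ^ (1 / m) ∈ Ioi (0 : ℝ) := fun w hw =>
    Real.rpow_pos_of_pos hw _
  have hps : ContDiffOn ℝ (⊤ : ℕ∞) (fun w : ℝ => w ^ (1 / m)) (Ioi 0) :=
    contDiffOn_id.rpow_const_of_ne fun t ht => ne_of_gt ht
  have hs : ContDiffOn ℝ (⊤ : ℕ∞) h (Ioi 0) :=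
    (hf.smooth.comp hps hpow).sub contDiffOn_const
  have hfd : ∀ t, 0 < t → DifferentiableAt ℝ (fun t => f t - f 0) t := fun t ht =>
    ((hf.smooth.differentiableOn (by simp)).differentiableAt (isOpen_Ioi.mem_nhds ht)).sub_const _
  have hhd : ∀ t, 0 < t → DifferentiableAt ℝ h t := fun t ht =>
    (hs.differentiableOn (by simp)).differentiableAt (isOpen_Ioi.mem_nhds ht)
  have hhB : ∀ t, 0 < t → |h t| ≤ B := fun t ht => hB _ (hpow t ht)
  have hsteps : ekSteps (-a) = 1 := by
    rw [ekSteps, if_neg (by linarith), neg_neg, Nat.floor_eq_zero.2 ha1]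
  have hβ' : -a + 1 = β := by rw [hβdef]; ring
  have hem : EqOn (fun w => eulerOp (fun t => f t - f 0) (w ^ (1 / m))) (fun w => m * eulerOp h w)
      (Ioi 0) := fun w hw => eulerOp_rpow hm hw (hfd _ (hpow w hw))
  obtain ⟨hc1, hc2⟩ : EKRecConverges m 0 0 (-a + 1) (fun t => f t - f 0) ∧
      EKRecConverges m 0 0 (-a + 1) (eulerOp fun t => f t - f 0) := by
    have := hf.converges
    rw [sub_sub_cancel, hsteps] at this
    exact this
  rw [hβ', ekRecConverges_zero_iff hm] at hc1 hc2
  have hce : BetaConverges β (eulerOp h) := betaConverges_of_const_mul hm.ne' (hc2.congr hem)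
  have hmain : ∀ τ, 0 < τ → betaMean β (eulerOp h) τ =
      -(κ * Real.Gamma β / m ^ a) * (τ ^ a * g (τ ^ (1 / m))) - β * betaMean β h τ := by
    intro τ hτ
    have ht := hpow τ hτ
    have h1 := heq _ ht
    have htm : (τ ^ (1 / m)) ^ m = τ := by
      rw [← Real.rpow_mul hτ.le, one_div_mul_cancel hm.ne', Real.rpow_one]
    rw [caputoPow, mcBridePow, sub_sub_cancel, erdelyiKober, hsteps] at h1
    simp only [ekRec.eq_2] at h1
    rw [hβ', ekRec_zero_eq_betaMean hm ht, ekRec_zero_eq_betaMean hm ht, htm,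
      betaMean_congr hem hτ, betaMean_const_mul, Real.rpow_neg (le_of_lt ht),
      Real.rpow_mul (le_of_lt ht), htm, zero_add, hβ'] at h1
    field_simp at h1 ⊢
    linear_combination h1
  have hr : ContinuousOn (betaMean β (eulerOp h)) (Ioi 0) := by
    refine ContinuousOn.congr ?_ fun τ hτ => hmain τ hτ
    refine ContinuousOn.sub (continuousOn_const.mul (ContinuousOn.mul ?_ ?_))
      (continuousOn_const.mul (continuousOn_betaMean hβ hs.continuousOn hhB))
    · exact (Real.continuous_rpow_const ha.le).continuousOn
    · exact hg.comp hps.continuousOn hpow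
  have h1 := hasDerivAt_betaMean hβ hhd (contDiffOn_deriv hs).continuousOn hc1 hce hr hτ
  refine ((Real.hasDerivAt_rpow_const (p := β) (Or.inl hτ.ne')).mul h1).congr_deriv ?_
  rw [hmain τ hτ, Real.rpow_sub_one hτ.ne']
  have : τ ^ a * τ ^ β = τ := by
    rw [← Real.rpow_add hτ, hβdef, add_sub_cancel, Real.rpow_one]
  field_simp
  linear_combination (-(g (τ ^ (1 / m)) * κ * Real.Gamma β)) * this

/-- For `a = 1` the recursion is used twice, and the equation `ᶜL f = -κ g` is the differential
equation `m h' = -κ g(w^{1/m})`. -/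
lemma hasDerivAt_of_caputoPow_one {m κ : ℝ} (hm : 0 < m) {f g : ℝ → ℝ}
    (hf : CaputoDomain (1 - m) 1 f) (hg : ContinuousOn g (Ioi 0))
    (heq : ∀ t, 0 < t → caputoPow (1 - m) 1 f t = -κ * g t) {τ : ℝ} (hτ : 0 < τ) :
    HasDerivAt (fun w => f (w ^ (1 / m)) - f 0) (-(κ / m) * g (τ ^ (1 / m))) τ := by
  set h : ℝ → ℝ := fun w => f (w ^ (1 / m)) - f 0
  have hpow : ∀ w ∈ Ioi (0 : ℝ), w ^ (1 / m) ∈ Ioi (0 : ℝ) := fun w hw =>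
    Real.rpow_pos_of_pos hw _
  have hps : ContDiffOn ℝ (⊤ : ℕ∞) (fun w : ℝ => w ^ (1 / m)) (Ioi 0) :=
    contDiffOn_id.rpow_const_of_ne fun t ht => ne_of_gt ht
  have hs : ContDiffOn ℝ (⊤ : ℕ∞) h (Ioi 0) :=
    (hf.smooth.comp hps hpow).sub contDiffOn_const
  have hdiff : ∀ {F : ℝ → ℝ}, ContDiffOn ℝ (⊤ : ℕ∞) F (Ioi 0) → ∀ t, 0 < t →
      DifferentiableAt ℝ F t := fun hF t ht =>
    (hF.differentiableOn (by simp)).differentiableAt (isOpen_Ioi.mem_nhds ht)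
  set y : ℝ → ℝ := eulerOp h with hy
  have hys : ContDiffOn ℝ (⊤ : ℕ∞) y (Ioi 0) := contDiffOn_id.mul (contDiffOn_deriv hs)
  have hfs : ContDiffOn ℝ (⊤ : ℕ∞) (fun t => f t - f 0) (Ioi 0) := hf.smooth.sub contDiffOn_const
  have hfes : ContDiffOn ℝ (⊤ : ℕ∞) (eulerOp fun t => f t - f 0) (Ioi 0) :=
    contDiffOn_id.mul (contDiffOn_deriv hfs)
  have hsteps : ekSteps (-1) = 2 := by
    rw [ekSteps, if_neg (by norm_num), neg_neg, Nat.floor_one]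
  have hem : EqOn (fun w => eulerOp (fun t => f t - f 0) (w ^ (1 / m))) (fun w => m * y w)
      (Ioi 0) := fun w hw => eulerOp_rpow hm hw (hdiff hfs _ (hpow w hw))
  have hem2 : EqOn (fun w => eulerOp (eulerOp fun t => f t - f 0) (w ^ (1 / m)))
      (fun w => m ^ 2 * eulerOp y w) (Ioi 0) := fun w hw => by
    have hw0 : (0 : ℝ) < w := hw
    simp only
    rw [eulerOp_rpow hm hw0 (hdiff hfes _ (hpow w hw)), eulerOp_congr hem hw, eulerOp,
      ((hdiff hys w hw0).hasDerivAt.const_mul m).deriv, eulerOp]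
    ring
  have horder : (-1 : ℝ) + 1 + 1 = 1 := by norm_num
  obtain ⟨-, hc1, hc2⟩ : _ ∧ EKRecConverges m 0 0 (-1 + 1 + 1) (eulerOp fun t => f t - f 0) ∧
      EKRecConverges m 0 0 (-1 + 1 + 1) (eulerOp (eulerOp fun t => f t - f 0)) := by
    have := hf.converges
    rw [sub_sub_cancel, hsteps] at this
    exact this
  rw [horder, ekRecConverges_zero_iff hm] at hc1 hc2
  have hcy : BetaConverges 1 y := betaConverges_of_const_mul hm.ne' (hc1.congr hem)
  have hcey : BetaConverges 1 (eulerOp y) :=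
    betaConverges_of_const_mul (pow_ne_zero 2 hm.ne') (hc2.congr hem2)
  have hmain : ∀ τ, 0 < τ → betaMean 1 (eulerOp y) τ =
      -(κ / m) * (τ * g (τ ^ (1 / m))) - betaMean 1 y τ := by
    intro τ hτ
    have ht := hpow τ hτ
    have h1 := heq _ ht
    have htm : (τ ^ (1 / m)) ^ m = τ := by
      rw [← Real.rpow_mul hτ.le, one_div_mul_cancel hm.ne', Real.rpow_one]
    rw [caputoPow, mcBridePow, sub_sub_cancel, erdelyiKober, hsteps] at h1
    simp only [ekRec.eq_2] at h1
    rw [horder, ekRec_zero_eq_betaMean hm ht, ekRec_zero_eq_betaMean hm ht,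
      ekRec_zero_eq_betaMean hm ht, htm, betaMean_congr hem hτ, betaMean_const_mul,
      betaMean_congr hem2 hτ, betaMean_const_mul, Real.rpow_neg (le_of_lt ht), mul_one, htm,
      Real.rpow_one, Real.Gamma_one] at h1
    norm_num at h1
    field_simp at h1 ⊢
    linear_combination h1
  -- the mean of `y` of order `1` is `τ⁻¹ ∫₀^τ y`, so that `τ betaMean 1 y τ` has the derivative `y`
  have hmean : ∀ τ, 0 < τ → ∫ w in (0 : ℝ)..τ, y w = τ * betaMean 1 y τ := fun τ hτ => by
    have := integral_sub_rpow_mul (β := 1) hτ y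
    simpa using this
  have hint : ∀ τ, 0 < τ → HasDerivAt (fun τ => ∫ w in (0 : ℝ)..τ, y w) (y τ) τ := fun τ hτ =>
    intervalIntegral.integral_hasDerivAt_right (intervalIntegrable_of_betaConverges hcy hτ)
      (hys.continuousOn.stronglyMeasurableAtFilter isOpen_Ioi τ hτ)
      (hys.continuousOn.continuousAt (isOpen_Ioi.mem_nhds hτ))
  have hbc : ContinuousOn (betaMean 1 y) (Ioi 0) := by
    refine ContinuousOn.congr (f := fun τ => τ⁻¹ * ∫ w in (0 : ℝ)..τ, y w) ?_ fun τ hτ => ?_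
    · exact (continuousOn_id.inv₀ fun τ hτ => ne_of_gt hτ).mul
        fun τ hτ => (hint τ hτ).continuousAt.continuousWithinAt
    · simp only [hmean τ hτ]
      rw [inv_mul_cancel_left₀ (ne_of_gt hτ)]
  have hr : ContinuousOn (betaMean 1 (eulerOp y)) (Ioi 0) := by
    refine ContinuousOn.congr ?_ fun τ hτ => hmain τ hτ
    exact (continuousOn_const.mul (continuousOn_id.mul (hg.comp hps.continuousOn hpow))).sub hbc
  have h1 := (hasDerivAt_id τ).mul (hasDerivAt_betaMean one_pos (hdiff hys)
    (contDiffOn_deriv hys).continuousOn hcy hcey hr hτ)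
  have h2 := (hint τ hτ).congr_of_eventuallyEq (f₁ := id * betaMean 1 y) (by
    filter_upwards [eventually_gt_nhds hτ] with s hs using (hmean s hs).symm)
  have h3 := h1.unique h2
  rw [hmain τ hτ, hy, eulerOp, id] at h3
  have h4 : deriv h τ = -(κ / m) * g (τ ^ (1 / m)) := by
    have h5 : τ * (m * deriv h τ + κ * g (τ ^ (1 / m))) = 0 := by
      field_simp at h3
      linear_combination -h3
    have h6 := (mul_eq_zero.1 h5).resolve_left hτ.ne'
    field_simp
    linear_combination h6
  rw [← h4]
  exact (hdiff hs τ hτ).hasDerivAt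

/-- In the variable `w = t ^ m`, the Caputo-like power of order `a` acts on Laplace transforms as
the Caputo derivative, up to the factor `m ^ a`. -/
theorem laplace_caputoPow {m a κ B B' : ℝ} (hm : 0 < m) (ha : 0 < a) (ha1 : a ≤ 1) {f g : ℝ → ℝ}
    (hf : CaputoDomain (1 - m) a f) (hB : ∀ t, 0 < t → |f t - f 0| ≤ B)
    (hg : ContinuousOn g (Ioi 0)) (hB' : ∀ t, 0 < t → |g t| ≤ B')
    (heq : ∀ t, 0 < t → caputoPow (1 - m) a f t = -κ * g t) {z : ℝ} (hz : 0 < z) :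
    m ^ a * z ^ a * ∫ w in Ioi 0, Real.exp (-(z * w)) * (f (w ^ (1 / m)) - f 0) =
      -κ * ∫ w in Ioi 0, Real.exp (-(z * w)) * g (w ^ (1 / m)) := by
  have hpow : ∀ w ∈ Ioi (0 : ℝ), w ^ (1 / m) ∈ Ioi (0 : ℝ) := fun w hw =>
    Real.rpow_pos_of_pos hw _
  have hpc : ContinuousOn (fun w : ℝ => w ^ (1 / m)) (Ioi 0) :=
    (Real.continuous_rpow_const (by positivity)).continuousOn
  have hgc : ContinuousOn (fun w => g (w ^ (1 / m))) (Ioi 0) := hg.comp hpc hpow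
  have hhc : ContinuousOn (fun w => f (w ^ (1 / m)) - f 0) (Ioi 0) :=
    (hf.smooth.continuousOn.comp hpc hpow).sub continuousOn_const
  have hhB : ∀ w, 0 < w → |f (w ^ (1 / m)) - f 0| ≤ B := fun w hw => hB _ (hpow w hw)
  have hB0 : 0 ≤ B := (abs_nonneg _).trans (hB 1 one_pos)
  have hcg : ∀ c : ℝ, ∀ w, 0 < w → |c * g (w ^ (1 / m))| ≤ |c| * B' := fun c w hw => by
    rw [abs_mul]
    gcongr
    exact hB' _ (hpow w hw)
  have hout : ∀ c : ℝ, ∫ w in Ioi 0, Real.exp (-(z * w)) * (c * g (w ^ (1 / m))) =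
      c * ∫ w in Ioi 0, Real.exp (-(z * w)) * g (w ^ (1 / m)) := fun c => by
    rw [← integral_const_mul]
    congr 1 with w
    ring
  rcases ha1.lt_or_eq with ha1 | rfl
  · have hβ : 0 < 1 - a := by linarith
    have hΓ := Real.Gamma_pos_of_pos hβ
    set I := ∫ x in (0 : ℝ)..1, (1 - x) ^ (1 - a - 1)
    have hI : 0 ≤ I := intervalIntegral.integral_nonneg zero_le_one fun x hx => by
      have : 0 ≤ 1 - x := by linarith [hx.2]
      positivity
    have hWB : ∀ τ, 0 < τ →
        |τ ^ (1 - a) * betaMean (1 - a) (fun w => f (w ^ (1 / m)) - f 0) τ| ≤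
          τ ^ (1 - a) * (B * I) := fun τ hτ => by
      rw [abs_mul, abs_of_pos (by positivity)]
      gcongr
      exact abs_betaMean_le hβ hhB hτ
    have h1 := laplace_of_hasDerivAt (C := B * I)
      (fun τ hτ => hasDerivAt_of_caputoPow_lt_one hm ha ha1 hf hB hg heq hτ) ?_ (fun τ hτ => ?_)
      (continuousOn_const.mul hgc) (hcg _) hz
    · rw [hout] at h1
      have h2 : ∫ τ in Ioi 0, Real.exp (-(z * τ)) *
          (τ ^ (1 - a) * betaMean (1 - a) (fun w => f (w ^ (1 / m)) - f 0) τ) =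
          ∫ τ in Ioi 0, Real.exp (-(z * τ)) * ∫ w in (0 : ℝ)..τ, (τ - w) ^ (1 - a - 1) *
            (f (w ^ (1 / m)) - f 0) :=
        setIntegral_congr_fun measurableSet_Ioi fun τ hτ => by
          rw [integral_sub_rpow_mul hτ (fun w => f (w ^ (1 / m)) - f 0)]
      rw [h2, laplace_integral_sub_rpow_mul hβ hz hhc hhB, Real.rpow_sub hz, Real.rpow_one] at h1
      field_simp at h1
      linear_combination h1
    · have h0 : Tendsto (fun τ : ℝ => τ ^ (1 - a) * (B * I)) (𝓝[>] 0) (𝓝 0) := by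
        have : Tendsto (fun τ : ℝ => τ ^ (1 - a) * (B * I)) (𝓝 0)
            (𝓝 ((0 : ℝ) ^ (1 - a) * (B * I))) :=
          ((Real.continuous_rpow_const hβ.le).mul continuous_const).tendsto 0
        rw [Real.zero_rpow hβ.ne', zero_mul] at this
        exact this.mono_left nhdsWithin_le_nhds
      refine squeeze_zero_norm' ?_ h0
      filter_upwards [self_mem_nhdsWithin] with τ hτ using hWB τ hτ
    · refine (hWB τ hτ).trans ?_
      rw [mul_comm]
      gcongr
      rcases le_total τ 1 with h | h
      · linarith [Real.rpow_le_one hτ.le h hβ.le]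
      · linarith [Real.rpow_le_self_of_one_le h (show 1 - a ≤ 1 by linarith)]
  · have h1 := laplace_of_hasDerivAt (C := B)
      (fun τ hτ => hasDerivAt_of_caputoPow_one hm hf hg heq hτ) ?_ (fun τ hτ => ?_)
      (continuousOn_const.mul hgc) (hcg _) hz
    · rw [hout] at h1
      rw [Real.rpow_one, Real.rpow_one]
      field_simp at h1
      linear_combination h1
    · have h0 : Tendsto (fun w : ℝ => w ^ (1 / m)) (𝓝[>] 0) (𝓝[>] 0) := by
        refine tendsto_nhdsWithin_of_tendsto_nhds_of_eventually_within _ ?_ ?_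
        · have hm' : 0 < 1 / m := by positivity
          have : Tendsto (fun w : ℝ => w ^ (1 / m)) (𝓝 0) (𝓝 ((0 : ℝ) ^ (1 / m))) :=
            (Real.continuous_rpow_const hm'.le).tendsto 0
          rw [Real.zero_rpow hm'.ne'] at this
          exact this.mono_left nhdsWithin_le_nhds
        · filter_upwards [self_mem_nhdsWithin] with w hw using hpow w hw
      simpa using (hf.tendsto_zero.comp h0).sub_const (f 0)
    · refine (hhB τ hτ).trans ?_
      nlinarith

/-! ### Uniqueness for the Cauchy problem -/

/-- Bounded solutions of the Cauchy problem are unique, by induction on `k`: the equation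
determines the Laplace transform of `pₖ(w^{1/m})` from that of `pₖ₋₁(w^{1/m})`. -/
theorem SolvesCauchy.eqOn {H a κ : ℝ} (hH : 0 < H) (ha : 0 < a) (ha1 : a ≤ 1) (hκ : 0 < κ)
    {p q : ℕ → ℝ → ℝ} (hp : SolvesCauchy H a κ p) (hq : SolvesCauchy H a κ q)
    (hpb : ∀ k t, |p k t| ≤ 1) (hqb : ∀ k t, |q k t| ≤ 1) (k : ℕ) : EqOn (p k) (q k) (Ici 0) := by
  have hm : 0 < 2 * H := by positivity
  suffices h : ∀ k, EqOn (p k) (q k) (Ioi 0) by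
    intro t ht
    rcases eq_or_lt_of_le (mem_Ici.1 ht) with rfl | ht
    · rw [hp.initial, hq.initial]
    · exact h k ht
  have hpow : ∀ w ∈ Ioi (0 : ℝ), w ^ (1 / (2 * H)) ∈ Ioi (0 : ℝ) := fun w hw =>
    Real.rpow_pos_of_pos hw _
  have hpc : ContinuousOn (fun w : ℝ => w ^ (1 / (2 * H))) (Ioi 0) :=
    (Real.continuous_rpow_const (by positivity)).continuousOn
  have hshift : ∀ {p : ℕ → ℝ → ℝ}, SolvesCauchy H a κ p → (∀ k t, |p k t| ≤ 1) → ∀ k,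
      ContinuousOn (backShift p k) (Ioi 0) ∧ ∀ t, |backShift p k t| ≤ 1 := fun hp hpb k => by
    rcases k with _ | k
    · exact ⟨continuousOn_const, fun t => by simp [backShift]⟩
    · exact ⟨(hp.domain k).smooth.continuousOn, hpb k⟩
  have hlap : ∀ {p : ℕ → ℝ → ℝ}, SolvesCauchy H a κ p → (∀ k t, |p k t| ≤ 1) → ∀ k z, 0 < z →
      (2 * H) ^ a * z ^ a * ((∫ w in Ioi 0, Real.exp (-(z * w)) * p k (w ^ (1 / (2 * H)))) -
        ∫ w in Ioi 0, Real.exp (-(z * w)) * p k 0) =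
      -κ * ((∫ w in Ioi 0, Real.exp (-(z * w)) * p k (w ^ (1 / (2 * H)))) -
        ∫ w in Ioi 0, Real.exp (-(z * w)) * backShift p k (w ^ (1 / (2 * H)))) := by
    intro p hp hpb k z hz
    have hb2 : ∀ x y : ℝ, |x| ≤ 1 → |y| ≤ 1 → |x - y| ≤ 2 := fun x y hx hy =>
      (abs_sub x y).trans (by linarith)
    have h1 := laplace_caputoPow (B := 2) (B' := 2) hm ha ha1 (hp.domain k)
      (fun t _ => hb2 _ _ (hpb k t) (hpb k 0))
      ((hp.domain k).smooth.continuousOn.sub (hshift hp hpb k).1)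
      (fun t _ => hb2 _ _ (hpb k t) ((hshift hp hpb k).2 t)) (hp.equation k) hz
    have hi1 : IntegrableOn (fun w => Real.exp (-(z * w)) * p k (w ^ (1 / (2 * H)))) (Ioi 0) :=
      integrableOn_exp_neg_mul_mul hz ((hp.domain k).smooth.continuousOn.comp hpc hpow)
      (fun w _ => hpb k (w ^ (1 / (2 * H))))
    have hi2 : IntegrableOn (fun w => Real.exp (-(z * w)) * backShift p k (w ^ (1 / (2 * H))))
        (Ioi 0) := integrableOn_exp_neg_mul_mul hz ((hshift hp hpb k).1.comp hpc hpow)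
      (fun w _ => (hshift hp hpb k).2 (w ^ (1 / (2 * H))))
    rw [← integral_sub hi1 ((integrableOn_exp_neg_mul hz).mul_const _), ← integral_sub hi1 hi2]
    simpa only [Pi.sub_apply, mul_sub, Function.comp_apply] using h1
  have hstep : ∀ k, EqOn (backShift p k) (backShift q k) (Ioi 0) → EqOn (p k) (q k) (Ioi 0) := by
    intro k hk
    have hpi : ∀ {z : ℝ}, 0 < z →
        IntegrableOn (fun w => Real.exp (-(z * w)) * p k (w ^ (1 / (2 * H)))) (Ioi 0) := fun hz =>
      integrableOn_exp_neg_mul_mul hz ((hp.domain k).smooth.continuousOn.comp hpc hpow)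
        (fun w _ => hpb k (w ^ (1 / (2 * H))))
    have hqi : ∀ {z : ℝ}, 0 < z →
        IntegrableOn (fun w => Real.exp (-(z * w)) * q k (w ^ (1 / (2 * H)))) (Ioi 0) := fun hz =>
      integrableOn_exp_neg_mul_mul hz ((hq.domain k).smooth.continuousOn.comp hpc hpow)
        (fun w _ => hqb k (w ^ (1 / (2 * H))))
    have hzero := eqOn_zero_of_laplace_eq_zero (z₀ := 1)
      (f := fun w => p k (w ^ (1 / (2 * H))) - q k (w ^ (1 / (2 * H))))
      (((hp.domain k).smooth.continuousOn.comp hpc hpow).sub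
        ((hq.domain k).smooth.continuousOn.comp hpc hpow))
      (by
        simp only [mul_sub]
        exact (hpi one_pos).sub (hqi one_pos))
      (fun z hz => by
        have hz0 : 0 < z := by linarith
        have hlp := hlap hp hpb k z hz0
        have hlq := hlap hq hqb k z hz0
        have hback : ∫ w in Ioi 0, Real.exp (-(z * w)) * backShift p k (w ^ (1 / (2 * H))) =
            ∫ w in Ioi 0, Real.exp (-(z * w)) * backShift q k (w ^ (1 / (2 * H))) :=
          setIntegral_congr_fun measurableSet_Ioi fun w hw => by
            rw [hk (hpow w hw)]
        rw [hback, hp.initial, ← hq.initial] at hlp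
        simp only [mul_sub]
        rw [integral_sub (hpi hz0) (hqi hz0)]
        have hpos : 0 < (2 * H) ^ a * z ^ a + κ := by positivity
        refine (mul_eq_zero.1 ?_).resolve_left hpos.ne'
        linear_combination hlp - hlq)
    intro t ht
    have ht0 : (0 : ℝ) < t := ht
    have := hzero (x := t ^ (2 * H)) (mem_Ioi.2 (by positivity))
    simp only [Pi.zero_apply] at this
    rw [← Real.rpow_mul ht0.le, mul_one_div_cancel hm.ne', Real.rpow_one] at this
    exact sub_eq_zero.1 this
  intro k
  induction k with
  | zero => exact hstep 0 fun t _ => rfl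
  | succ k ih => exact hstep (k + 1) ih

/-! ### Right-continuous integer paths on a countable set of times -/

/-- The value at time `s` of the right-continuous path through the monotone data `n` on the rational
times: the infimum of `n` over the rational times after `s`. In contrast to the evaluation of a path
indexed by all times, it is jointly measurable in `n` and `s`. -/
noncomputable def pathFrom (n : ℚ≥0 → ℕ) (s : ℝ≥0) : ℕ :=
  sInf (n '' {q : ℚ≥0 | s < (q : ℝ≥0)})

lemma exists_nnrat_gt (s : ℝ≥0) : ∃ q : ℚ≥0, s < (q : ℝ≥0) := by
  obtain ⟨k, hk⟩ := exists_nat_gt s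
  exact ⟨k, by simpa using hk⟩

lemma exists_nnrat_btwn {s r : ℝ≥0} (h : s < r) : ∃ q : ℚ≥0, s < (q : ℝ≥0) ∧ (q : ℝ≥0) < r := by
  obtain ⟨q, hq1, hq2⟩ := exists_rat_btwn (NNReal.coe_lt_coe.2 h)
  have hq0 : 0 ≤ q := by
    have : (0 : ℝ) ≤ q := s.coe_nonneg.trans hq1.le
    exact_mod_cast this
  lift q to ℚ≥0 using hq0
  refine ⟨q, ?_, ?_⟩
  · rw [← NNReal.coe_lt_coe, show ((q : ℝ≥0) : ℝ) = ((q : ℚ) : ℝ) from rfl]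
    exact_mod_cast hq1
  · rw [← NNReal.coe_lt_coe, show ((q : ℝ≥0) : ℝ) = ((q : ℚ) : ℝ) from rfl]
    exact_mod_cast hq2

lemma pathFrom_le (n : ℚ≥0 → ℕ) {s : ℝ≥0} {q : ℚ≥0} (h : s < (q : ℝ≥0)) : pathFrom n s ≤ n q :=
  Nat.sInf_le ⟨q, h, rfl⟩

lemma exists_eq_pathFrom (n : ℚ≥0 → ℕ) (s : ℝ≥0) :
    ∃ q : ℚ≥0, s < (q : ℝ≥0) ∧ n q = pathFrom n s := by
  obtain ⟨q, hq⟩ := exists_nnrat_gt s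
  exact Nat.sInf_mem (s := n '' {q : ℚ≥0 | s < (q : ℝ≥0)}) ⟨_, q, hq, rfl⟩

lemma monotone_pathFrom (n : ℚ≥0 → ℕ) : Monotone (pathFrom n) := fun s r h => by
  obtain ⟨q, hq, hn⟩ := exists_eq_pathFrom n r
  rw [← hn]
  exact pathFrom_le n (h.trans_lt hq)

lemma continuousWithinAt_pathFrom (n : ℚ≥0 → ℕ) (s : ℝ≥0) :
    ContinuousWithinAt (pathFrom n) (Ici s) s := by
  obtain ⟨q, hq, hn⟩ := exists_eq_pathFrom n s
  refine tendsto_const_nhds.congr' ?_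
  filter_upwards [self_mem_nhdsWithin, mem_nhdsWithin_of_mem_nhds (Iio_mem_nhds hq)] with r hr hrq
  exact le_antisymm (monotone_pathFrom n hr) (hn ▸ pathFrom_le n hrq)

lemma measurable_pathFrom : Measurable fun p : (ℚ≥0 → ℕ) × ℝ≥0 => pathFrom p.1 p.2 := by
  refine measurable_of_Iic fun k => ?_
  have : (fun p : (ℚ≥0 → ℕ) × ℝ≥0 => pathFrom p.1 p.2) ⁻¹' Iic k =
      ⋃ q : ℚ≥0, {p | p.2 < (q : ℝ≥0)} ∩ {p | p.1 q ≤ k} := by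
    ext p
    simp only [mem_preimage, mem_Iic, mem_iUnion, mem_inter_iff, mem_ofPred_eq]
    constructor
    · intro h
      obtain ⟨q, hq, hn⟩ := exists_eq_pathFrom p.1 p.2
      exact ⟨q, hq, hn ▸ h⟩
    · rintro ⟨q, hq, hk⟩
      exact (pathFrom_le p.1 hq).trans hk
  rw [this]
  refine MeasurableSet.iUnion fun q => (measurableSet_lt measurable_snd measurable_const).inter
    (measurableSet_le ((measurable_pi_apply q).comp measurable_fst) measurable_const)

lemma measurable_pathFrom_left (s : ℝ≥0) : Measurable fun n => pathFrom n s :=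
  measurable_pathFrom.comp (measurable_id.prodMk measurable_const)

lemma pathFrom_restrict {x : ℝ≥0 → ℕ} (hm : Monotone x)
    (hr : ∀ t, ContinuousWithinAt x (Ici t) t) (s : ℝ≥0) :
    pathFrom (fun q => x q) s = x s := by
  have h1 : ∀ᶠ r in 𝓝[≥] s, x r = x s :=
    (hr s).eventually_mem (s := {x s}) (by simp)
  obtain ⟨r, hr, h2⟩ := (mem_nhdsGE_iff_exists_Ico_subset).1 h1
  obtain ⟨q, hq1, hq2⟩ := exists_nnrat_btwn (mem_Ioi.1 hr)
  refine le_antisymm ?_ ?_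
  · rw [← show x q = x s from h2 ⟨hq1.le, hq2⟩]
    exact pathFrom_le (fun q : ℚ≥0 => x q) hq1
  · obtain ⟨q, hq, hn⟩ := exists_eq_pathFrom (fun q : ℚ≥0 => x q) s
    rw [← hn]
    exact hm hq.le

/-! ### The law of a Poisson process at an independent random time -/

section RandomTime

variable {lam : ℝ} {ρ : Measure (ℚ≥0 → ℕ)} [IsProbabilityMeasure ρ]

lemma real_prod_pathFrom (hlam : 0 ≤ lam)
    (hρ : ∀ s : ℝ≥0, ρ.map (fun n => pathFrom n s) = poissonMeasure (lam * s).toNNReal)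
    (μ : Measure ℝ) [IsProbabilityMeasure μ] (c : ℝ≥0) (k : ℕ) :
    (ρ.prod μ).real {p | pathFrom p.1 (c * ‖p.2‖₊) = k} = mixedPoisson μ k (lam * c) := by
  have hmeas : Measurable fun p : (ℚ≥0 → ℕ) × ℝ => pathFrom p.1 (c * ‖p.2‖₊) :=
    measurable_pathFrom.comp (measurable_fst.prodMk (by fun_prop))
  change ((ρ.prod μ) ((fun p : (ℚ≥0 → ℕ) × ℝ => pathFrom p.1 (c * ‖p.2‖₊)) ⁻¹' {k})).toReal = _
  rw [Measure.prod_apply_symm (hmeas (measurableSet_singleton k)), mixedPoisson,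
    integral_eq_lintegral_of_nonneg_ae]
  · congr 1
    refine lintegral_congr fun y => ?_
    have hs : 0 ≤ lam * (c * ‖y‖₊ : ℝ≥0) := by positivity
    have h1 := congrArg (fun m : Measure ℕ => m {k}) (hρ (c * ‖y‖₊))
    rw [Measure.map_apply (measurable_pathFrom_left _)
      (measurableSet_singleton k), poissonMeasure_singleton, Real.coe_toNNReal _ hs] at h1
    refine h1.trans ?_
    rw [NNReal.coe_mul, coe_nnnorm, Real.norm_eq_abs, ← mul_assoc]
  · refine ae_of_all _ fun y => ?_
    have : 0 ≤ lam * c * |y| := by positivity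
    simp only [Pi.zero_apply]
    positivity
  · fun_prop

lemma integral_pow_prod_pathFrom (hlam : 0 ≤ lam)
    (hρ : ∀ s : ℝ≥0, ρ.map (fun n => pathFrom n s) = poissonMeasure (lam * s).toNNReal)
    (μ : Measure ℝ) [IsProbabilityMeasure μ] (c : ℝ≥0) {u : ℝ} (hu : |u| ≤ 1) :
    ∫ p, u ^ pathFrom p.1 (c * ‖p.2‖₊) ∂(ρ.prod μ) =
      ∫ x, Real.exp (-(lam * (1 - u) * c * |x|)) ∂μ := by
  have hmeas : Measurable fun p : (ℚ≥0 → ℕ) × ℝ => pathFrom p.1 (c * ‖p.2‖₊) :=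
    measurable_pathFrom.comp (measurable_fst.prodMk (by fun_prop))
  have hint : Integrable (fun p : (ℚ≥0 → ℕ) × ℝ => u ^ pathFrom p.1 (c * ‖p.2‖₊)) (ρ.prod μ) := by
    refine (integrable_const (1 : ℝ)).mono'
      ((measurable_of_countable fun k : ℕ => u ^ k).comp hmeas).aestronglyMeasurable
      (ae_of_all _ fun p => ?_)
    rw [norm_pow]
    exact pow_le_one₀ (norm_nonneg u) hu
  rw [integral_prod_symm _ hint]
  congr 1 with y
  have hs : 0 ≤ lam * (c * ‖y‖₊ : ℝ≥0) := by positivity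
  have h1 := integral_map (μ := ρ) (measurable_pathFrom_left (c * ‖y‖₊)).aemeasurable
    (f := fun k : ℕ => u ^ k)
    (measurable_of_countable _).aestronglyMeasurable
  rw [hρ, integral_poissonMeasure] at h1
  rw [← h1, Real.coe_toNNReal _ hs, NNReal.coe_mul, coe_nnnorm, Real.norm_eq_abs]
  set r := lam * (c * |y|)
  have h2 : HasSum (fun n : ℕ => (Real.exp (-r) * r ^ n / n.factorial) • u ^ n)
      (Real.exp (-r) * Real.exp (r * u)) := by
    have h3 := (NormedSpace.expSeries_div_hasSum_exp (r * u)).mul_left (Real.exp (-r))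
    rw [← Real.exp_eq_exp_ℝ] at h3
    refine h3.congr_fun fun n => ?_
    rw [smul_eq_mul, mul_pow]
    ring
  rw [h2.tsum_eq, ← Real.exp_add]
  congr 1
  ring

end RandomTime

lemma identDistrib_of_real_eq {Ω Ω' : Type*} [MeasurableSpace Ω] [MeasurableSpace Ω']
    {P : Measure Ω} {P' : Measure Ω'} [IsFiniteMeasure P] [IsFiniteMeasure P'] {X : Ω → ℕ}
    {Y : Ω' → ℕ} (hX : AEMeasurable X P) (hY : AEMeasurable Y P')
    (h : ∀ k, P.real {ω | X ω = k} = P'.real {ω | Y ω = k}) : IdentDistrib X Y P P' := by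
  refine ⟨hX, hY, Measure.ext_of_singleton fun k => ?_⟩
  rw [Measure.map_apply_of_aemeasurable hX (measurableSet_singleton k),
    Measure.map_apply_of_aemeasurable hY (measurableSet_singleton k)]
  exact (measureReal_eq_measureReal_iff).1 (h k)

section PoissonProcess

variable {Ω : Type*} [MeasurableSpace Ω] {P : Measure Ω} {lam : ℝ} {N : ℝ≥0 → Ω → ℕ}

lemma IsPoissonProcess.ae_pathFrom (hN : IsPoissonProcess lam N P) :
    ∀ᵐ ω ∂P, ∀ s, pathFrom (fun q => N q ω) s = N s ω := by
  filter_upwards [hN.mono, hN.rightCts] with ω h1 h2 s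
  exact pathFrom_restrict (x := fun t => N t ω) h1 h2 s

lemma IsPoissonProcess.measurable_rat (hN : IsPoissonProcess lam N P) :
    Measurable fun ω => fun q : ℚ≥0 => N q ω :=
  measurable_pi_lambda _ fun q => hN.measurable q

lemma IsPoissonProcess.map_pathFrom (hN : IsPoissonProcess lam N P) (s : ℝ≥0) :
    (P.map fun ω => fun q : ℚ≥0 => N q ω).map (fun n => pathFrom n s) =
      poissonMeasure (lam * s).toNNReal := by
  have hlaw := (hN.law 0 s zero_le).map_eq
  rw [NNReal.coe_zero, sub_zero] at hlaw
  rw [Measure.map_map (measurable_pathFrom_left s) hN.measurable_rat, ← hlaw]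
  refine Measure.map_congr ?_
  filter_upwards [hN.ae_pathFrom, hN.zero] with ω h1 h2
  simp [h1, h2]

lemma IsPoissonProcess.reflectedTimeChange_ae_eq (hN : IsPoissonProcess lam N P)
    (G : ℝ≥0 → Ω → ℝ) (t : ℝ≥0) :
    reflectedTimeChange N G t =ᵐ[P] fun ω => pathFrom (fun q => N q ω) ‖G t ω‖₊ := by
  filter_upwards [hN.ae_pathFrom] with ω h
  rw [h, reflectedTimeChange]

/-- Independence of the whole processes is used only for the restriction of `N` to the rational
times and for `G(t)`. -/
lemma map_rat_prodMk [IsProbabilityMeasure P] (hN : IsPoissonProcess lam N P) {G : ℝ≥0 → Ω → ℝ}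
    (hG : ∀ t, Measurable (G t)) (hNG : IndepFun (fun ω s => N s ω) (fun ω t => G t ω) P)
    (t : ℝ≥0) :
    P.map (fun ω => ((fun q : ℚ≥0 => N q ω), G t ω)) =
      (P.map fun ω => fun q : ℚ≥0 => N q ω).prod (P.map (G t)) := by
  have h1 : Measurable fun (x : ℝ≥0 → ℕ) (q : ℚ≥0) => x q :=
    measurable_pi_lambda _ fun q => measurable_pi_apply _
  have h2 : Measurable fun x : ℝ≥0 → ℝ => x t := measurable_pi_apply t
  exact (indepFun_iff_map_prod_eq_prod_map_map hN.measurable_rat.aemeasurable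
    (hG t).aemeasurable).1 (hNG.comp h1 h2)

end PoissonProcess

/-! ### Scaling of the grey Brownian motion -/

section GGBM

variable {Ω : Type*} [MeasurableSpace Ω] {P : Measure Ω} {H ν c : ℝ} {G : ℝ≥0 → Ω → ℝ}

lemma IsGGBM.charFun_one (hG : IsGGBM H ν c G P) (hH : 0 < H) (hc : c ^ 2 = (2 * H) ^ ν) (γ : ℝ) :
    charFun (P.map (G 1)) γ = (mittagLeffler (2 * (ν / 2)) 1 (-γ ^ 2) : ℂ) := by
  have : (2 * H) ^ ν ≠ 0 := by positivity
  rw [hG.law, hc, div_self this, NNReal.coe_one, Real.one_rpow, one_mul, mul_one,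
    mul_div_cancel₀ ν two_ne_zero]

/-- Self-similarity of the laws at single times: `G(t)` has the law of `t ^ (H ν) G(1)`. -/
lemma IsGGBM.map_eq [IsProbabilityMeasure P] (hG : IsGGBM H ν c G P) (hH : 0 < H)
    (hc : c ^ 2 = (2 * H) ^ ν) (t : ℝ≥0) :
    P.map (G t) = (P.map (G 1)).map (fun x => (t : ℝ) ^ (2 * H * (ν / 2)) * x) := by
  have h0 : (2 * H) ^ ν ≠ 0 := by positivity
  refine Measure.ext_of_charFun (funext fun γ => ?_)
  rw [charFun_map_mul, hG.charFun_one hH hc, hG.law, hc, div_self h0, one_mul,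
    mul_div_cancel₀ ν two_ne_zero, mul_pow, ← Real.rpow_mul_natCast t.coe_nonneg]
  congr 3
  rw [mul_comm]
  congr 2
  push_cast
  ring

end GGBM

/-! ### The time-changed Poisson process -/

/-- The model of the counting process: `x(t ^ σ |y|)` for a path `x` given at the rational times and
a real number `y`. -/
noncomputable def scaledPath (σ : ℝ) (t : ℝ≥0) (p : (ℚ≥0 → ℕ) × ℝ) : ℕ :=
  pathFrom p.1 (t ^ σ * ‖p.2‖₊)

lemma measurable_scaledPath (σ : ℝ) (t : ℝ≥0) : Measurable (scaledPath σ t) :=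
  measurable_pathFrom.comp (measurable_fst.prodMk (by fun_prop))

lemma isCountingProcess_scaledPath {σ : ℝ} (hσ : 0 < σ) {ρ : Measure (ℚ≥0 → ℕ)}
    (h0 : ∀ᵐ n ∂ρ, pathFrom n 0 = 0) (μ : Measure ℝ) :
    IsCountingProcess (scaledPath σ) (ρ.prod μ) where
  measurable := measurable_scaledPath σ
  zero := by
    filter_upwards [Measure.quasiMeasurePreserving_fst.ae h0] with p hp
    rw [scaledPath, NNReal.zero_rpow hσ.ne', zero_mul, hp]
  mono := ae_of_all _ fun p s t h =>
    monotone_pathFrom _ (mul_le_mul_left (NNReal.rpow_le_rpow h hσ.le) _)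
  rightCts := ae_of_all _ fun p t => by
    refine ContinuousWithinAt.comp (t := Ici (t ^ σ * ‖p.2‖₊))
      (f := fun s : ℝ≥0 => s ^ σ * ‖p.2‖₊) (continuousWithinAt_pathFrom p.1 _) ?_ fun s hs => ?_
    · exact ((NNReal.continuous_rpow_const hσ.le).mul continuous_const).continuousWithinAt
    · exact mem_Ici.2 (mul_le_mul_left (NNReal.rpow_le_rpow hs hσ.le) _)

lemma mixedPoisson_map_mul (μ : Measure ℝ) (k : ℕ) {r : ℝ} (hr : 0 ≤ r) (s : ℝ) :
    mixedPoisson (μ.map (fun x => r * x)) k s = mixedPoisson μ k (s * r) := by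
  rw [mixedPoisson, mixedPoisson, integral_map (by fun_prop) (by fun_prop)]
  simp only [abs_mul, abs_of_nonneg hr, mul_assoc]

lemma abs_stateProb_le_one {Ω : Type*} [MeasurableSpace Ω] (P : Measure Ω)
    [IsProbabilityMeasure P] (X : ℝ≥0 → Ω → ℕ) (k : ℕ) (t : ℝ) : |stateProb P X k t| ≤ 1 := by
  rw [stateProb, abs_of_nonneg measureReal_nonneg]
  exact measureReal_le_one

section TimeChange

variable {Ω : Type*} [MeasurableSpace Ω] {P : Measure Ω} {lam : ℝ} {N : ℝ≥0 → Ω → ℕ}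
  {G : ℝ≥0 → Ω → ℝ}

lemma aemeasurable_reflectedTimeChange (hN : IsPoissonProcess lam N P)
    (hG : ∀ t, Measurable (G t)) (t : ℝ≥0) : AEMeasurable (reflectedTimeChange N G t) P :=
  ⟨fun ω => pathFrom (fun q => N q ω) ‖G t ω‖₊,
    measurable_pathFrom.comp (hN.measurable_rat.prodMk (hG t).nnnorm),
    hN.reflectedTimeChange_ae_eq G t⟩

lemma real_reflectedTimeChange [IsProbabilityMeasure P] (hlam : 0 ≤ lam)
    (hN : IsPoissonProcess lam N P) (hG : ∀ t, Measurable (G t))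
    (hNG : IndepFun (fun ω s => N s ω) (fun ω t => G t ω) P) (t : ℝ≥0) (k : ℕ) :
    P.real {ω | reflectedTimeChange N G t ω = k} = mixedPoisson (P.map (G t)) k lam := by
  have hρ := Measure.isProbabilityMeasure_map (μ := P) hN.measurable_rat.aemeasurable
  have hμ := Measure.isProbabilityMeasure_map (μ := P) (hG t).aemeasurable
  have h := real_prod_pathFrom hlam hN.map_pathFrom (P.map (G t)) 1 k
  rw [NNReal.coe_one, mul_one, ← map_rat_prodMk hN hG hNG] at h
  have hm : Measurable fun p : (ℚ≥0 → ℕ) × ℝ => pathFrom p.1 (1 * ‖p.2‖₊) :=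
    measurable_pathFrom.comp (measurable_fst.prodMk (by fun_prop))
  have hset : MeasurableSet {p : (ℚ≥0 → ℕ) × ℝ | pathFrom p.1 (1 * ‖p.2‖₊) = k} :=
    hm (measurableSet_singleton k)
  rw [← h, map_measureReal_apply (hN.measurable_rat.prodMk (hG t)) hset]
  refine measureReal_congr ?_
  filter_upwards [hN.reflectedTimeChange_ae_eq G t] with ω hω
  change (reflectedTimeChange N G t ω = k) = (pathFrom (fun q => N q ω) (1 * ‖G t ω‖₊) = k)
  rw [hω, one_mul]

lemma integral_pow_reflectedTimeChange [IsProbabilityMeasure P] (hlam : 0 ≤ lam)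
    (hN : IsPoissonProcess lam N P) (hG : ∀ t, Measurable (G t))
    (hNG : IndepFun (fun ω s => N s ω) (fun ω t => G t ω) P) (t : ℝ≥0) {u : ℝ} (hu : |u| ≤ 1) :
    ∫ ω, u ^ reflectedTimeChange N G t ω ∂P =
      ∫ x, Real.exp (-(lam * (1 - u) * |x|)) ∂(P.map (G t)) := by
  have hρ := Measure.isProbabilityMeasure_map (μ := P) hN.measurable_rat.aemeasurable
  have hμ := Measure.isProbabilityMeasure_map (μ := P) (hG t).aemeasurable
  have h := integral_pow_prod_pathFrom hlam hN.map_pathFrom (P.map (G t)) 1 hu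
  have hm : Measurable fun p : (ℚ≥0 → ℕ) × ℝ => u ^ pathFrom p.1 (1 * ‖p.2‖₊) :=
    (measurable_of_countable fun k : ℕ => u ^ k).comp
      (measurable_pathFrom.comp (measurable_fst.prodMk (by fun_prop)))
  rw [NNReal.coe_one, mul_one, ← map_rat_prodMk hN hG hNG,
    integral_map (hN.measurable_rat.prodMk (hG t)).aemeasurable hm.aestronglyMeasurable] at h
  rw [← h]
  refine integral_congr_ae ?_
  filter_upwards [hN.reflectedTimeChange_ae_eq G t] with ω hω
  rw [hω, one_mul]

end TimeChange

theorem theorem5p1 (H ν c lam : ℝ) (hH : 0 < H ∧ H < 1) (hν : 0 < ν ∧ ν ≤ 2)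
    (hlam : 0 < lam) (hc : c ^ 2 = (2 * H) ^ ν)
    {Ω : Type*} [MeasurableSpace Ω] (P : Measure Ω) [IsProbabilityMeasure P]
    (N : ℝ≥0 → Ω → ℕ) (G : ℝ≥0 → Ω → ℝ)
    (hN : IsPoissonProcess lam N P) (hG : IsGGBM H ν c G P)
    (hNG : IndepFun (fun ω s => N s ω) (fun ω t => G t ω) P) :
    -- the state probabilities of `N(|G|)` solve the Cauchy problem, within McBride's spaces
    SolvesCauchy H (ν / 2) (lam * (2 * H) ^ (ν / 2)) (stateProb P (reflectedTimeChange N G)) ∧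
    (∃ p μ : ℝ, 1 ≤ p ∧ 1 / p < 2 * H + μ ∧ ∀ k, MemFWeighted p μ
      (fun t => stateProb P (reflectedTimeChange N G) k t -
        stateProb P (reflectedTimeChange N G) k 0)) ∧
    -- there is a counting process with these state probabilities
    (∃ (Ω' : Type) (_ : MeasurableSpace Ω') (P' : Measure Ω') (M : ℝ≥0 → Ω' → ℕ),
      IsProbabilityMeasure P' ∧ IsCountingProcess M P' ∧
      SolvesCauchy H (ν / 2) (lam * (2 * H) ^ (ν / 2)) (stateProb P' M) ∧
      ∀ t, IdentDistrib (reflectedTimeChange N G t) (M t) P P') ∧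
    -- every process whose state probabilities solve the Cauchy problem has the laws of `N(|G|)`
    (∀ {Ω' : Type*} [MeasurableSpace Ω'] (P' : Measure Ω') [IsProbabilityMeasure P']
      (M : ℝ≥0 → Ω' → ℕ), (∀ t, Measurable (M t)) →
      SolvesCauchy H (ν / 2) (lam * (2 * H) ^ (ν / 2)) (stateProb P' M) →
      ∀ t, IdentDistrib (reflectedTimeChange N G t) (M t) P P') ∧
    -- the probability generating function
    (∀ (t : ℝ≥0) (u : ℝ), |u| ≤ 1 →
      ∫ ω, u ^ reflectedTimeChange N G t ω ∂P =
        mittagLeffler (ν / 2) 1 (-(lam * (1 - u) * (t : ℝ) ^ (H * ν)))) := by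
  have hH0 := hH.1
  have ha : 0 < ν / 2 := by linarith [hν.1]
  have ha1 : ν / 2 ≤ 1 := by linarith [hν.2]
  set a := ν / 2 with ha_def
  set σ := 2 * H * a with hσ_def
  have hσ : 0 < σ := by positivity
  have hμ := Measure.isProbabilityMeasure_map (μ := P) (hG.measurable 1).aemeasurable
  have hρ := Measure.isProbabilityMeasure_map (μ := P) hN.measurable_rat.aemeasurable
  set μ := P.map (G 1)
  set ρ := P.map (fun ω => fun q : ℚ≥0 => N q ω)
  -- the laws at time `1` determine everything: all state probabilities are those of a Poisson
  -- variable with the random mean `lam * t ^ σ * |G 1|`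
  have hLap : ∀ s, 0 ≤ s → ∫ x, Real.exp (-(s * |x|)) ∂μ = mittagLeffler a 1 (-s) :=
    fun s hs => integral_exp_neg_mul_abs ha μ (hG.charFun_one hH0 hc) hs
  have hprob : ∀ (t : ℝ≥0) (k : ℕ), P.real {ω | reflectedTimeChange N G t ω = k} =
      mixedPoisson μ k (lam * (t : ℝ) ^ σ) := fun t k => by
    rw [real_reflectedTimeChange hlam.le hN hG.measurable hNG, hG.map_eq hH0 hc,
      mixedPoisson_map_mul _ _ (by positivity)]
  have hprob' : ∀ (t : ℝ≥0) (k : ℕ), (ρ.prod μ).real {p | scaledPath σ t p = k} =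
      mixedPoisson μ k (lam * (t : ℝ) ^ σ) := fun t k => by
    rw [← NNReal.coe_rpow]
    exact real_prod_pathFrom hlam.le hN.map_pathFrom μ (t ^ σ) k
  have hsolve : ∀ {q : ℕ → ℝ → ℝ},
      (∀ k t, 0 ≤ t → q k t = mixedPoisson μ k (lam * t ^ σ)) →
      SolvesCauchy H a (lam * (2 * H) ^ a) q := fun hq =>
    solvesCauchy_of_eq_powSum hH0 ha fun k t ht => by
      rw [hq k t ht, mixedPoisson_eq_powSum ha μ hLap k (by positivity)]
  have hstate : ∀ k t, 0 ≤ t → stateProb P (reflectedTimeChange N G) k t =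
      mixedPoisson μ k (lam * t ^ σ) := fun k t ht => by
    rw [stateProb, hprob, Real.coe_toNNReal t ht]
  have hsol := hsolve hstate
  refine ⟨hsol, ⟨1, 1 + σ / 2, le_rfl, by linarith, fun k => ?_⟩, ?_, ?_, ?_⟩
  · refine (memFWeighted_mixedIncrement ha hlam hσ μ hLap k).congr fun t ht => ?_
    simp only
    rw [hstate k t (le_of_lt ht), hsol.initial, mixedIncrement]
  -- the paths of `N` on the rational times, together with one independent copy of `G 1`, carry the
  -- counting process
  · refine ⟨(ℚ≥0 → ℕ) × ℝ, inferInstance, ρ.prod μ, scaledPath σ, inferInstance,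
      isCountingProcess_scaledPath hσ ?_ μ, ?_, fun t => ?_⟩
    · refine (ae_map_iff hN.measurable_rat.aemeasurable
        ((measurable_pathFrom_left 0) (measurableSet_singleton 0))).2 ?_
      filter_upwards [hN.ae_pathFrom, hN.zero] with ω h1 h2
      exact (h1 0).trans h2
    · exact hsolve fun k t ht => by
        rw [stateProb, hprob', Real.coe_toNNReal t ht]
    · exact identDistrib_of_real_eq (aemeasurable_reflectedTimeChange hN hG.measurable t)
        (measurable_scaledPath σ t).aemeasurable fun k => by rw [hprob, hprob']
  · intro Ω' _ P' _ M hM hMsol t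
    refine identDistrib_of_real_eq (aemeasurable_reflectedTimeChange hN hG.measurable t)
      (hM t).aemeasurable fun k => ?_
    have := hsol.eqOn hH0 ha ha1 (by positivity) hMsol (abs_stateProb_le_one P _)
      (abs_stateProb_le_one P' M) k (mem_Ici.2 t.coe_nonneg)
    simpa only [stateProb, Real.toNNReal_coe] using this
  · intro t u hu
    have hu1 : 0 ≤ 1 - u := by linarith [le_abs_self u]
    have hmap : P.map (G t) = μ.map (fun x => (t : ℝ) ^ σ * x) := hG.map_eq hH0 hc t
    rw [integral_pow_reflectedTimeChange hlam.le hN hG.measurable hNG t hu, hmap,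
      integral_map (by fun_prop) (by fun_prop), show H * ν = σ by rw [hσ_def, ha_def]; ring,
      ← hLap _ (by positivity)]
    simp only [abs_mul, abs_of_nonneg (Real.rpow_nonneg t.coe_nonneg _), mul_assoc]
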